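/- **Setting.** There are $n$ agents at positions $x=(x_1,\dots,x_n)\in[0,1]^n$ and two facilities with capacities $q_1,q_2\ge 0$; facility $j$ can accommodate $\lfloor q_j n\rfloor$ agents. Given facility positions $y=(y_1,y_2)\in\mathbb{R}^2$, the agents play the following first-come-first-served game: each agent selects a facility; among the agents that selected facility $j$, the $\lfloor q_jn\rfloor$ closest to $y_j$ (ties being broken by an arbitrary fixed priority order, which may depend on $n$ and $j$) are accommodated; an agent at $x_i$ accommodated by facility $j$ has utility $1-|x_i-y_j|$, and an agent that is not accommodated has utility $0$. The social welfare of a pure Nash equilibrium is the sum of all utilities. For $p=(p_1,p_2)\in[0,1]^2$, the percentile mechanism $\mathcal{PM}_p$ places facility $j$ at the position of the $(\lfloor p_j(n-1)\rfloor+1)$-th leftmost agent. A mechanism is *equilibrium stable* if, for every $n$ and every $x\in[0,1]^n$, the game induced by its output has a pure Nash equilibrium and all its pure Nash equilibria attain the same social welfare. Let $SW_p(x)$ be the social welfare of the worst equilibrium of the game induced by $\mathcal{PM}_p(x)$ (thus of every equilibrium if $\mathcal{PM}_p$ is equilibrium stable), and let $SW_{\rm opt}(x)$ be the supremum of the social welfare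 over all $y\in\mathbb{R}^2$ and all equilibria of the game induced by $y$. Let $X_n$ be a vector of $n$ independent agents with law $\mu$. The mechanism is *asymptotically optimal* if $\frac1n\mathbb{E}[SW_p(X_n)]$ and $\frac1n\mathbb{E}[SW_{\rm opt}(X_n)]$ converge to the same limit as $n\to\infty$ and the Bayesian approximation ratio $\mathbb{E}[SW_{\rm opt}(X_n)]/\mathbb{E}[SW_p(X_n)]$ tends to $1$. **Theorem.** Let $q_1,q_2\ge 0$ with $0<q_1+q_2\le\frac23$. Let $\mu$ be a probability measure on $[0,1]$ with a density $f$ that is single-dipped, i.e. for some $d\in[0,1]$, $f$ is non-increasing on $(0,1)\cap(-\infty,d]$ and non-decreasing on $(0,1)\cap[d,\infty)$, and let $\mu$ be symmetric, i.e. invariant under $x\mapsto 1-x$. Then the percentile mechanism $\mathcal{PM}_p$ with $p=\left(\frac{q_1}{2},\,1-\frac{q_2}{2}\right)$ is equilibrium stable and asymptotically optimal. -/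

import Mathlib

open MeasureTheory Filter Topology

noncomputable section

namespace FacilityLocation

/-- The number of agents out of `n` that facility `j` can accommodate. -/
def capacity {m : ℕ} (q : Fin m → ℝ) (n : ℕ) (j : Fin m) : ℕ := ⌊q j * n⌋₊

/-- Agent `l` comes before agent `i` at a facility located at `y`: `l` is strictly closer to `y`, or
it is equally close and the tie is resolved in favour of `l` by the priority order `τ`. -/
def Ahead {n : ℕ} (τ : Equiv.Perm (Fin n)) (x : Fin n → ℝ) (y : ℝ) (l i : Fin n) : Prop :=
  |x l - y| < |x i - y| ∨ (|x l - y| = |x i - y| ∧ τ l < τ i)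

/-- First-come-first-served: under the strategy profile `s`, agent `i` is accommodated by the
facility `s i` it selected iff fewer than `cap (s i)` agents with the same selection come before. -/
def Accommodated {n m : ℕ} (cap : Fin m → ℕ) (τ : Fin m → Equiv.Perm (Fin n)) (x : Fin n → ℝ)
    (y : Fin m → ℝ) (s : Fin n → Fin m) (i : Fin n) : Prop :=
  {l : Fin n | s l = s i ∧ Ahead (τ (s i)) x (y (s i)) l i}.ncard < cap (s i)

open scoped Classical in
/-- The utility of agent `i` under the strategy profile `s`. -/
def utility {n m : ℕ} (cap : Fin m → ℕ) (τ : Fin m → Equiv.Perm (Fin n)) (x : Fin n → ℝ)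
    (y : Fin m → ℝ) (s : Fin n → Fin m) (i : Fin n) : ℝ :=
  if Accommodated cap τ x y s i then 1 - |x i - y (s i)| else 0

/-- Pure Nash equilibria of the first-come-first-served game. -/
def IsNash {n m : ℕ} (cap : Fin m → ℕ) (τ : Fin m → Equiv.Perm (Fin n)) (x : Fin n → ℝ)
    (y : Fin m → ℝ) (s : Fin n → Fin m) : Prop :=
  ∀ (i : Fin n) (j : Fin m),
    utility cap τ x y (Function.update s i j) i ≤ utility cap τ x y s i

/-- The social welfare under the strategy profile `s`. -/
def socialWelfare {n m : ℕ} (cap : Fin m → ℕ) (τ : Fin m → Equiv.Perm (Fin n)) (x : Fin n → ℝ)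
    (y : Fin m → ℝ) (s : Fin n → Fin m) : ℝ :=
  ∑ i, utility cap τ x y s i

/-- The social welfares attained by the Nash equilibria for the facility positions `y`. -/
def nashWelfares {n m : ℕ} (cap : Fin m → ℕ) (τ : Fin m → Equiv.Perm (Fin n)) (x : Fin n → ℝ)
    (y : Fin m → ℝ) : Set ℝ :=
  {w | ∃ s : Fin n → Fin m, IsNash cap τ x y s ∧ w = socialWelfare cap τ x y s}

/-- `SW_opt(x)`: the largest social welfare over all facility positions and all equilibria. -/
def optWelfare {n m : ℕ} (cap : Fin m → ℕ) (τ : Fin m → Equiv.Perm (Fin n)) (x : Fin n → ℝ) : ℝ :=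
  sSup {w | ∃ y : Fin m → ℝ, w ∈ nashWelfares cap τ x y}

/-- A mechanism, for every number `n` of agents, sends reports to facility positions. -/
abbrev Mechanism (m : ℕ) : Type := ∀ n : ℕ, (Fin n → ℝ) → (Fin m → ℝ)

/-- The position of the `k`-th leftmost agent, counting from `0` (junk value `0` if `n ≤ k`). -/
def orderStat {n : ℕ} (x : Fin n → ℝ) (k : ℕ) : ℝ :=
  if h : k < n then x (Tuple.sort x ⟨k, h⟩) else 0

/-- The percentile mechanism of `p`: facility `j` is placed at the `(⌊p_j (n - 1)⌋ + 1)`-th leftmost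
agent, which has index `⌊p_j (n - 1)⌋` when agents are counted from `0`. -/
def percentileMechanism {m : ℕ} (p : Fin m → ℝ) : Mechanism m :=
  fun n x j => orderStat x ⌊p j * ((n : ℝ) - 1)⌋₊

/-- A mechanism is equilibrium stable if on every input in `[0,1]^n` its output induces exactly one
value of the social welfare at equilibrium. -/
def EquilibriumStable {m : ℕ} (q : Fin m → ℝ) (τ : ∀ n : ℕ, Fin m → Equiv.Perm (Fin n))
    (M : Mechanism m) : Prop :=
  ∀ (n : ℕ) (x : Fin n → ℝ), (∀ i, x i ∈ Set.Icc (0 : ℝ) 1) →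
    ∃ w : ℝ, nashWelfares (capacity q n) (τ n) x (M n x) = {w}

/-- The social welfare of a mechanism on the instance `x`: that of the worst equilibrium (and hence
of every equilibrium if the mechanism is equilibrium stable). -/
def mechWelfare {m : ℕ} (q : Fin m → ℝ) (τ : ∀ n : ℕ, Fin m → Equiv.Perm (Fin n))
    (M : Mechanism m) (n : ℕ) (x : Fin n → ℝ) : ℝ :=
  sInf (nashWelfares (capacity q n) (τ n) x (M n x))

/-- The expectation of a nonnegative quantity depending on `n` independent agents with law `μ`. -/
def expect (μ : Measure ℝ) (n : ℕ) (g : (Fin n → ℝ) → ℝ) : ℝ :=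
  (∫⁻ x, ENNReal.ofReal (g x) ∂(Measure.pi fun _ : Fin n => μ)).toReal

/-- The Bayesian approximation ratio of a mechanism for `n` agents. -/
def bayesRatio {m : ℕ} (μ : Measure ℝ) (q : Fin m → ℝ)
    (τ : ∀ n : ℕ, Fin m → Equiv.Perm (Fin n)) (M : Mechanism m) (n : ℕ) : ℝ :=
  expect μ n (optWelfare (capacity q n) (τ n)) / expect μ n (mechWelfare q τ M n)

/-- A mechanism is asymptotically optimal if its expected social welfare per agent and the optimal
one converge to the same limit, and its Bayesian approximation ratio tends to `1`. -/
def AsymptoticallyOptimal {m : ℕ} (μ : Measure ℝ) (q : Fin m → ℝ)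
    (τ : ∀ n : ℕ, Fin m → Equiv.Perm (Fin n)) (M : Mechanism m) : Prop :=
  (∃ L : ℝ,
    Tendsto (fun n : ℕ => expect μ n (mechWelfare q τ M n) / n) atTop (𝓝 L) ∧
    Tendsto (fun n : ℕ => expect μ n (optWelfare (capacity q n) (τ n)) / n) atTop (𝓝 L)) ∧
  Tendsto (fun n : ℕ => bayesRatio μ q τ M n) atTop (𝓝 1)

/-- `μ` is carried by `[0,1]` and has a density that first is non-increasing and then non-decreasing.
Monotonicity is not asked at the endpoints `0` and `1`, where the density may be unbounded. -/
def IsSingleDipped (μ : Measure ℝ) : Prop :=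
  ∃ f : ℝ → ℝ, Measurable f ∧ (∀ x, 0 ≤ f x) ∧
    μ = (volume.restrict (Set.Icc (0 : ℝ) 1)).withDensity (fun x => ENNReal.ofReal (f x)) ∧
    ∃ d ∈ Set.Icc (0 : ℝ) 1,
      AntitoneOn f (Set.Ioo 0 1 ∩ Set.Iic d) ∧ MonotoneOn f (Set.Ioo 0 1 ∩ Set.Ici d)

/-- `μ` is invariant under the reflection of `[0,1]`. -/
def IsSymmetric (μ : Measure ℝ) : Prop := μ.map (fun x => 1 - x) = μ

end FacilityLocation

end

/-! Stability. Let r be half the distance between the two facilities. Since 3/2 · (q₁ + q₂) ≤ 1,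
enough agents lie between the percentile positions to fill both facilities. If one facility has
enough agents strictly within r to fill it, these strictly prefer it; so every equilibrium serves
the closest agents there, and the other facility takes the closest of the rest
(`socialWelfare_of_preferred`). Otherwise every equilibrium fills both facilities, serves all agents
closer than r and gives the remaining places to agents at distance exactly r
(`socialWelfare_of_scarce`). In both cases the welfare does not depend on the equilibrium.

Optimality. For capacities k_j and any ρ_j ≤ 1, every profile has welfare at most ∑_j (k_j (1 - ρ_j)
+ ∑_i max 0 (ρ_j - |x_i - y_j|)) (`socialWelfare_le`), a dual bound that decouples the facilities.
For a facility at z, take ρ such that [z - ρ, z + ρ] has mass q; in the limit one then has to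
minimise the cost of serving a window of mass q from a point. For a symmetric single-dipped law, the
density at u is at least that at u + l when 2u + l ≤ 1. Hence sliding a window towards the nearer
end of [0,1] does not decrease its mass, and a window at the end, served from its median, is
cheapest (`integral_extreme_window_le`). The percentile positions are these medians, up to rounding.

Conversely, the percentile equilibrium is at least as good as serving the leftmost agents at one
facility and the rightmost at the other (`le_mechWelfare`). Both bounds involve a number of
empirical sums that is independent of n (for the upper bound, through a finite net of positions),
and each deviates by at most √n in mean (`lintegral_deviation_le`). -/

namespace FacilityLocation

/-! ### Greedy selection from a finite set along a strict total order. -/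

section TopSet

variable {α : Type*}

open scoped Classical in
/-- The elements of `U` that have fewer than `k` predecessors in `U` for the relation `r`. -/
noncomputable def topSet (r : α → α → Prop) (U : Finset α) (k : ℕ) : Finset α :=
  U.filter fun i => (U.filter fun l => r l i).card < k

variable {r : α → α → Prop} {U : Finset α} {k : ℕ}

open scoped Classical in
theorem mem_topSet {i : α} :
    i ∈ topSet r U k ↔ i ∈ U ∧ (U.filter fun l => r l i).card < k := by
  simp [topSet]

theorem topSet_subset : topSet r U k ⊆ U := Finset.filter_subset _ _

variable [IsStrictTotalOrder α r]

open scoped Classical in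
theorem card_predecessors_lt {i l : α} (hl : l ∈ U) (h : r l i) :
    (U.filter fun j => r j l).card < (U.filter fun j => r j i).card := by
  apply Finset.card_lt_card
  rw [Finset.ssubset_iff_of_subset]
  · exact ⟨l, by simp [hl, h], by simp [irrefl_of r l]⟩
  · intro j hj
    simp only [Finset.mem_filter] at hj ⊢
    exact ⟨hj.1, trans_of r hj.2 h⟩

-- Along a strict total order, the number of predecessors is an injection from `U` to `{0, …, |U| -
-- 1}`, hence a bijection; the top set is the preimage of the numbers below `k`.
open scoped Classical in
theorem card_topSet : (topSet r U k).card = min k U.card := by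
  have hinj : Set.InjOn (fun i => (U.filter fun l => r l i).card) (U : Set α) := by
    intro i hi l hl h
    rcases trichotomous_of r i l with h' | h' | h'
    · exact absurd h (card_predecessors_lt hi h').ne
    · exact h'
    · exact absurd h (card_predecessors_lt hl h').ne'
  have himg : U.image (fun i => (U.filter fun l => r l i).card) = Finset.range U.card := by
    apply Finset.eq_of_subset_of_card_le
    · intro c hc
      obtain ⟨i, hi, rfl⟩ := Finset.mem_image.1 hc
      rw [Finset.mem_range]
      apply Finset.card_lt_card
      rw [Finset.ssubset_iff_of_subset (Finset.filter_subset _ _)]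
      exact ⟨i, hi, by simp [irrefl_of r i]⟩
    · rw [Finset.card_range, Finset.card_image_of_injOn hinj]
  have h : (topSet r U k).image (fun i => (U.filter fun l => r l i).card)
      = Finset.range (min k U.card) := by
    ext c
    constructor
    · intro hc
      obtain ⟨i, hi, rfl⟩ := Finset.mem_image.1 hc
      have h1 := mem_topSet.1 hi
      have h2 := Finset.mem_range.1 (himg ▸ Finset.mem_image_of_mem _ h1.1)
      exact Finset.mem_range.2 (lt_min h1.2 h2)
    · intro hc
      have hc' := lt_min_iff.1 (Finset.mem_range.1 hc)
      obtain ⟨i, hi, hic⟩ := Finset.mem_image.1 (himg ▸ Finset.mem_range.2 hc'.2)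
      exact Finset.mem_image.2 ⟨i, mem_topSet.2 ⟨hi, hic ▸ hc'.1⟩, hic⟩
  rw [← Finset.card_range (min k U.card), ← h, Finset.card_image_of_injOn]
  exact hinj.mono (by exact_mod_cast topSet_subset)

theorem rel_of_mem_topSet {i l : α} (hi : i ∈ topSet r U k) (hl : l ∈ U)
    (hl' : l ∉ topSet r U k) : r i l := by
  classical
  rcases trichotomous_of r i l with h | rfl | h
  · exact h
  · exact absurd hi hl'
  · exact absurd (mem_topSet.2 ⟨hl, (card_predecessors_lt hl h).trans (mem_topSet.1 hi).2⟩) hl'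

/-- Among the subsets of `U` with at most `k` elements, `topSet r U k` has the largest weight if the
weight is nonnegative and decreases along `r`. -/
theorem sum_le_sum_topSet {w : α → ℝ} (hw : ∀ i, 0 ≤ w i) (hr : ∀ i l, r i l → w l ≤ w i)
    {S : Finset α} (hS : S ⊆ U) (hk : S.card ≤ k) : ∑ i ∈ S, w i ≤ ∑ i ∈ topSet r U k, w i := by
  classical
  set T := topSet r U k with hT
  have hcard : S.card ≤ T.card := by
    rw [hT, card_topSet]
    exact le_min hk (Finset.card_le_card hS)
  have hcard' : (S \ T).card ≤ (T \ S).card := by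
    have h1 := Finset.card_sdiff_add_card_inter S T
    have h2 := Finset.card_sdiff_add_card_inter T S
    rw [Finset.inter_comm] at h2
    omega
  -- Exchange argument: every element of `T \ S` precedes the heaviest element of `S \ T`, and `T \
  -- S` has at least as many elements.
  have key : ∑ i ∈ S \ T, w i ≤ ∑ i ∈ T \ S, w i := by
    rcases (S \ T).eq_empty_or_nonempty with h | h
    · rw [h, Finset.sum_empty]
      exact Finset.sum_nonneg fun i _ => hw i
    · obtain ⟨m, hm, hmax⟩ := Finset.exists_max_image (S \ T) w h
      have hm' := Finset.mem_sdiff.1 hm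
      calc ∑ i ∈ S \ T, w i ≤ (S \ T).card • w m := Finset.sum_le_card_nsmul _ _ _ hmax
        _ ≤ (T \ S).card • w m := by
            simp only [nsmul_eq_mul]
            exact mul_le_mul_of_nonneg_right (by exact_mod_cast hcard') (hw m)
        _ ≤ ∑ i ∈ T \ S, w i := by
            apply Finset.card_nsmul_le_sum
            intro i hi
            exact hr _ _ (rel_of_mem_topSet (Finset.mem_sdiff.1 hi).1 (hS hm'.1) hm'.2)
  have h1 := Finset.sum_inter_add_sum_sdiff S T w
  have h2 := Finset.sum_inter_add_sum_sdiff T S w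
  rw [Finset.inter_comm] at h2
  linarith

end TopSet

/-! ### Payoffs, served agents and the dual bound on the welfare. -/

section Game

variable {n m : ℕ} {cap : Fin m → ℕ} {τ : Fin m → Equiv.Perm (Fin n)} {x : Fin n → ℝ}
  {y : Fin m → ℝ} {s : Fin n → Fin m}

instance isStrictTotalOrder_ahead (σ : Equiv.Perm (Fin n)) (x : Fin n → ℝ) (z : ℝ) :
    IsStrictTotalOrder (Fin n) (Ahead σ x z) where
  irrefl i h := by
    rcases h with h | h
    · exact lt_irrefl _ h
    · exact lt_irrefl _ h.2
  trans i j k hij hjk := by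
    rcases hij with hij | hij <;> rcases hjk with hjk | hjk
    · exact Or.inl (hij.trans hjk)
    · exact Or.inl (hjk.1 ▸ hij)
    · exact Or.inl (hij.1 ▸ hjk)
    · exact Or.inr ⟨hij.1.trans hjk.1, hij.2.trans hjk.2⟩
  trichotomous i j hij hji := by
    simp only [Ahead, not_or, not_and, not_lt] at hij hji
    have h := le_antisymm hji.1 hij.1
    exact σ.injective (le_antisymm (hji.2 h.symm) (hij.2 h))

theorem Ahead.le {σ : Equiv.Perm (Fin n)} {x : Fin n → ℝ} {z : ℝ} {l i : Fin n}
    (h : Ahead σ x z l i) : |x l - z| ≤ |x i - z| := by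
  rcases h with h | h
  · exact h.le
  · exact h.1.le

/-- The agents that select facility `j`. -/
def selectors (s : Fin n → Fin m) (j : Fin m) : Finset (Fin n) := Finset.univ.filter fun l => s l = j

theorem mem_selectors {j : Fin m} {l : Fin n} : l ∈ selectors s j ↔ s l = j := by
  simp [selectors]

open scoped Classical in
/-- What agent `i` receives by selecting facility `j` while the others play according to `s`. -/
noncomputable def payoff (cap : Fin m → ℕ) (τ : Fin m → Equiv.Perm (Fin n)) (x : Fin n → ℝ)
    (y : Fin m → ℝ) (s : Fin n → Fin m) (j : Fin m) (i : Fin n) : ℝ :=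
  if ((selectors s j).filter fun l => Ahead (τ j) x (y j) l i).card < cap j then 1 - |x i - y j|
  else 0

/-- The agents that are accommodated by facility `j`. -/
noncomputable def served (cap : Fin m → ℕ) (τ : Fin m → Equiv.Perm (Fin n)) (x : Fin n → ℝ)
    (y : Fin m → ℝ) (s : Fin n → Fin m) (j : Fin m) : Finset (Fin n) :=
  topSet (Ahead (τ j) x (y j)) (selectors s j) (cap j)

/-- No agent is ahead of itself, so the queue in front of a deviating agent can be counted in the
original profile. -/
theorem utility_update (i : Fin n) (j : Fin m) :
    utility cap τ x y (Function.update s i j) i = payoff cap τ x y s j i := by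
  classical
  have h : {l : Fin n | Function.update s i j l = j ∧ Ahead (τ j) x (y j) l i}
      = ((selectors s j).filter fun l => Ahead (τ j) x (y j) l i : Finset (Fin n)) := by
    ext l
    simp only [Set.mem_ofPred_eq, Finset.coe_filter, mem_selectors]
    by_cases hl : l = i
    · subst hl
      simp [irrefl_of (Ahead (τ j) x (y j)) l]
    · simp [Function.update_of_ne hl]
  simp only [utility, Accommodated, payoff, Function.update_self, h, Set.ncard_coe_finset]

theorem utility_eq_payoff (i : Fin n) : utility cap τ x y s i = payoff cap τ x y s (s i) i := by
  rw [← utility_update, Function.update_eq_self]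

theorem isNash_iff : IsNash cap τ x y s ↔
    ∀ i j, payoff cap τ x y s j i ≤ payoff cap τ x y s (s i) i := by
  simp only [IsNash, utility_update]
  simp only [utility_eq_payoff]

theorem payoff_nonneg {i : Fin n} {j : Fin m} (h : |x i - y j| ≤ 1) :
    0 ≤ payoff cap τ x y s j i := by
  unfold payoff
  split_ifs <;> linarith

theorem payoff_le {i : Fin n} {j : Fin m} (h : |x i - y j| ≤ 1) :
    payoff cap τ x y s j i ≤ 1 - |x i - y j| := by
  unfold payoff
  split_ifs <;> linarith

theorem payoff_of_mem_topSet {i : Fin n} {j : Fin m} {U : Finset (Fin n)}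
    (hU : selectors s j ⊆ U) (hi : i ∈ topSet (Ahead (τ j) x (y j)) U (cap j)) :
    payoff cap τ x y s j i = 1 - |x i - y j| := by
  classical
  refine if_pos (lt_of_le_of_lt (Finset.card_le_card ?_) (mem_topSet.1 hi).2)
  exact Finset.filter_subset_filter _ hU

theorem payoff_eq_zero_of_forall_ahead {i : Fin n} {j : Fin m} {T : Finset (Fin n)}
    (hT : T ⊆ selectors s j) (hcard : cap j ≤ T.card)
    (h : ∀ l ∈ T, Ahead (τ j) x (y j) l i) : payoff cap τ x y s j i = 0 := by
  classical
  refine if_neg (not_lt.2 (hcard.trans (Finset.card_le_card fun l hl => ?_)))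
  exact Finset.mem_filter.2 ⟨hT hl, h l hl⟩

theorem mem_served {i : Fin n} {j : Fin m} (hi : i ∈ served cap τ x y s j) : s i = j :=
  mem_selectors.1 (topSet_subset hi)

theorem card_served_le (j : Fin m) : (served cap τ x y s j).card ≤ cap j := by
  rw [served, card_topSet]
  exact min_le_left _ _

open scoped Classical in
theorem payoff_eq_ite (i : Fin n) : payoff cap τ x y s (s i) i =
    if i ∈ served cap τ x y s (s i) then 1 - |x i - y (s i)| else 0 := by
  simp [payoff, served, mem_topSet, mem_selectors]

theorem socialWelfare_eq_sum_served : socialWelfare cap τ x y s =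
    ∑ j, ∑ i ∈ served cap τ x y s j, (1 - |x i - y j|) := by
  classical
  have h : ∀ j, ∑ i ∈ served cap τ x y s j, (1 - |x i - y j|) =
      ∑ i, if i ∈ served cap τ x y s j then 1 - |x i - y j| else 0 := by
    intro j
    rw [← Finset.sum_filter]
    simp
  simp only [socialWelfare, utility_eq_payoff, h]
  rw [Finset.sum_comm]
  refine Finset.sum_congr rfl fun i _ => ?_
  rw [payoff_eq_ite]
  symm
  refine Finset.sum_eq_single (s i) (fun j _ hj => if_neg fun hi => hj (mem_served hi).symm) ?_
  simp

/-- Weak duality for serving at most `k` agents from a facility at `z`. -/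
theorem sum_le_threshold {S : Finset (Fin n)} {k : ℕ} (hS : S.card ≤ k) {ρ : ℝ} (hρ : ρ ≤ 1)
    (z : ℝ) :
    ∑ i ∈ S, (1 - |x i - z|) ≤ k * (1 - ρ) + ∑ i, max 0 (ρ - |x i - z|) := by
  have h1 : ∑ i ∈ S, (1 - |x i - z|) ≤ ∑ i ∈ S, ((1 - ρ) + max 0 (ρ - |x i - z|)) := by
    refine Finset.sum_le_sum fun i _ => ?_
    linarith [le_max_right 0 (ρ - |x i - z|)]
  have h2 : ∑ i ∈ S, max 0 (ρ - |x i - z|) ≤ ∑ i, max 0 (ρ - |x i - z|) :=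
    Finset.sum_le_sum_of_subset_of_nonneg (Finset.subset_univ _) fun i _ _ => le_max_left _ _
  have h3 : (S.card : ℝ) * (1 - ρ) ≤ k * (1 - ρ) :=
    mul_le_mul_of_nonneg_right (by exact_mod_cast hS) (by linarith)
  rw [Finset.sum_add_distrib, Finset.sum_const, nsmul_eq_mul] at h1
  linarith

/-- Only the capacities are used, not the equilibrium condition, so this bounds the optimum. -/
theorem socialWelfare_le {ρ : Fin m → ℝ} (hρ : ∀ j, ρ j ≤ 1) :
    socialWelfare cap τ x y s ≤
      ∑ j, (cap j * (1 - ρ j) + ∑ i, max 0 (ρ j - |x i - y j|)) := by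
  rw [socialWelfare_eq_sum_served]
  exact Finset.sum_le_sum fun j _ => sum_le_threshold (card_served_le j) (hρ j) _

end Game

/-! ### Equilibria with two facilities. -/

section TwoFacilities

variable {n : ℕ} {cap : Fin 2 → ℕ} {τ : Fin 2 → Equiv.Perm (Fin n)} {x : Fin n → ℝ}
  {y : Fin 2 → ℝ} {s : Fin n → Fin 2} {j j' : Fin 2}

/-- Lets the arguments below treat an unordered pair of facilities `j`, `j'` without splitting
cases. -/
theorem add_eq_zero_add_one {M : Type*} [AddCommMagma M] (g : Fin 2 → M) (h : j ≠ j') :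
    g j + g j' = g 0 + g 1 := by
  fin_cases j <;> fin_cases j' <;> simp_all [add_comm]

/-- If the closest agents to facility `j` do not prefer the other facility, then letting them select
`j` and all the others `j'` is an equilibrium. -/
theorem exists_isNash (hjj : j ≠ j') (hd : ∀ i j, |x i - y j| ≤ 1) (hcap : cap j ≤ n)
    (hT : ∀ i ∈ topSet (Ahead (τ j) x (y j)) Finset.univ (cap j), |x i - y j| ≤ |x i - y j'|) :
    ∃ s, IsNash cap τ x y s := by
  classical
  set T := topSet (Ahead (τ j) x (y j)) Finset.univ (cap j) with hTdef
  have hcard : T.card = cap j := by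
    rw [hTdef, card_topSet, Finset.card_univ, Fintype.card_fin, min_eq_left hcap]
  have hcover : ∀ l : Fin 2, l = j ∨ l = j' := by omega
  let s : Fin n → Fin 2 := fun i => if i ∈ T then j else j'
  refine ⟨s, isNash_iff.2 fun i l => ?_⟩
  by_cases hi : i ∈ T
  · have hsi : s i = j := if_pos hi
    rw [hsi, payoff_of_mem_topSet (Finset.subset_univ _) hi]
    rcases hcover l with rfl | rfl
    · exact payoff_le (hd _ _)
    · exact (payoff_le (hd _ _)).trans (by linarith [hT i hi])
  · have hsi : s i = j' := if_neg hi
    rw [hsi]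
    rcases hcover l with rfl | rfl
    · rw [payoff_eq_zero_of_forall_ahead (T := T)]
      · exact payoff_nonneg (hd _ _)
      · exact fun l hl => mem_selectors.2 (if_pos hl)
      · exact hcard.ge
      · exact fun l hl => rel_of_mem_topSet hl (Finset.mem_univ _) hi
    · exact le_rfl

/-- If the closest agents to facility `j` strictly prefer it, then they are served there, and the
other facility serves the agents closest to it among the remaining ones. -/
theorem socialWelfare_of_preferred (hjj : j ≠ j') (hd : ∀ i j, |x i - y j| ≤ 1) (hcap : cap j ≤ n)
    (hT : ∀ i ∈ topSet (Ahead (τ j) x (y j)) Finset.univ (cap j), |x i - y j| < |x i - y j'|)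
    (hs : IsNash cap τ x y s) :
    socialWelfare cap τ x y s =
      ∑ i ∈ topSet (Ahead (τ j) x (y j)) Finset.univ (cap j), (1 - |x i - y j|) +
      ∑ i ∈ topSet (Ahead (τ j') x (y j'))
        (topSet (Ahead (τ j) x (y j)) Finset.univ (cap j))ᶜ (cap j'), (1 - |x i - y j'|) := by
  classical
  set T := topSet (Ahead (τ j) x (y j)) Finset.univ (cap j) with hTdef
  set T' := topSet (Ahead (τ j') x (y j')) Tᶜ (cap j') with hTdef'
  have hcard : T.card = cap j := by
    rw [hTdef, card_topSet, Finset.card_univ, Fintype.card_fin, min_eq_left hcap]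
  have hcover : ∀ l : Fin 2, l = j ∨ l = j' := by omega
  rw [isNash_iff] at hs
  have hT1 : ∀ i ∈ T, s i = j := by
    intro i hi
    have h1 := hs i j
    rw [payoff_of_mem_topSet (Finset.subset_univ _) hi] at h1
    rcases hcover (s i) with h | h
    · exact h
    · rw [h] at h1
      linarith [hT i hi, payoff_le (cap := cap) (τ := τ) (s := s) (hd i j')]
  have hT2 : ∀ i ∉ T, payoff cap τ x y s j i = 0 := fun i hi =>
    payoff_eq_zero_of_forall_ahead (T := T) (fun l hl => mem_selectors.2 (hT1 l hl)) hcard.ge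
      fun l hl => rel_of_mem_topSet hl (Finset.mem_univ _) hi
  have hT3 : ∀ i ∉ T, payoff cap τ x y s (s i) i = payoff cap τ x y s j' i := by
    intro i hi
    rcases hcover (s i) with h | h
    · have h1 := hs i j'
      rw [h, hT2 i hi] at h1
      rw [h, hT2 i hi]
      exact le_antisymm (payoff_nonneg (hd _ _)) h1
    · rw [h]
  have hsub : selectors s j' ⊆ Tᶜ := by
    intro i hi
    rw [Finset.mem_compl]
    intro hiT
    exact hjj ((hT1 i hiT).symm.trans (mem_selectors.1 hi))
  have hT4 : ∀ i ∈ T', payoff cap τ x y s j' i = 1 - |x i - y j'| := fun i hi =>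
    payoff_of_mem_topSet hsub hi
  have hT5 : ∀ i, i ∉ T → i ∉ T' → payoff cap τ x y s j' i = 0 := by
    intro i hi hi'
    have hic : i ∈ Tᶜ := Finset.mem_compl.2 hi
    -- At distance 1 a place is worth 0, so an agent may be indifferent to it. At smaller distance,
    -- all of `T'` is ahead of `i` and gains a positive utility at `j'`, hence has to select `j'`.
    rcases (hd i j').lt_or_eq with hlt | heq
    · have hahead : ∀ l ∈ T', Ahead (τ j') x (y j') l i := fun l hl =>
        rel_of_mem_topSet hl hic hi'
      refine payoff_eq_zero_of_forall_ahead (T := T') (fun l hl => ?_) ?_ hahead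
      · rw [mem_selectors]
        have hlT := Finset.mem_compl.1 (topSet_subset hl)
        rcases hcover (s l) with h | h
        · have h1 := hs l j'
          rw [h, hT2 l hlT, hT4 l hl] at h1
          linarith [(hahead l hl).le]
        · exact h
      · rw [hTdef', card_topSet, le_min_iff]
        refine ⟨le_rfl, not_lt.1 fun hlt => hi' ?_⟩
        refine mem_topSet.2 ⟨hic, lt_of_le_of_lt (Finset.card_filter_le _ _) hlt⟩
    · exact le_antisymm ((payoff_le (hd _ _)).trans (by linarith)) (payoff_nonneg (hd _ _))
  have hdisj : ∀ i ∈ T', i ∉ T := fun i hi => Finset.mem_compl.1 (topSet_subset hi)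
  simp only [socialWelfare, utility_eq_payoff]
  rw [← Finset.sum_add_sum_compl T]
  congr 1
  · refine Finset.sum_congr rfl fun i hi => ?_
    rw [hT1 i hi, payoff_of_mem_topSet (Finset.subset_univ _) hi]
  · rw [← Finset.sum_subset (topSet_subset : T' ⊆ Tᶜ)]
    · exact Finset.sum_congr rfl fun i hi => by rw [hT3 i (hdisj i hi), hT4 i hi]
    · intro i hi hi'
      rw [hT3 i (Finset.mem_compl.1 hi), hT5 i (Finset.mem_compl.1 hi) hi']

open scoped Classical in
/-- If there are not enough agents closer than half the distance `2 * r` of the facilities to fill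
either of them, but sufficiently many agents between the facilities, then in every equilibrium all
places are taken by agents at distance at most `r`. -/
theorem socialWelfare_of_scarce {r : ℝ} (hd : ∀ i j, |x i - y j| ≤ 1) (hr : r < 1)
    (hdr : ∀ i, 2 * r ≤ |x i - y 0| + |x i - y 1|)
    (hD : ∀ j, (Finset.univ.filter fun i => |x i - y j| < r).card < cap j)
    (hB : cap 0 + cap 1 ≤ (Finset.univ.filter fun i => |x i - y 0| + |x i - y 1| = 2 * r).card)
    (hs : IsNash cap τ x y s) :
    socialWelfare cap τ x y s = ∑ j, (cap j * (1 - r) + ∑ i, max 0 (r - |x i - y j|)) := by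
  rw [isNash_iff] at hs
  have hsum : ∀ (j j' : Fin 2) (i : Fin n), j ≠ j' → 2 * r ≤ |x i - y j| + |x i - y j'| := by
    intro j j' i hjj
    rw [add_eq_zero_add_one (fun j => |x i - y j|) hjj]
    exact hdr i
  -- Fewer than `cap j` agents are within `r`, so such an agent always finds a place at `j`, and the
  -- other facility is farther than `r`.
  have hclose : ∀ j i, |x i - y j| < r → i ∈ served cap τ x y s j := by
    intro j i hi
    have h1 : payoff cap τ x y s j i = 1 - |x i - y j| := by
      refine if_pos (lt_of_le_of_lt (Finset.card_le_card fun l hl => ?_) (hD j))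
      have := (Finset.mem_filter.1 hl).2.le
      exact Finset.mem_filter.2 ⟨Finset.mem_univ _, by linarith⟩
    have h2 := hs i j
    have hsi : s i = j := by
      by_contra h
      linarith [hsum (s i) j i h, payoff_le (cap := cap) (τ := τ) (s := s) (hd i (s i))]
    rw [payoff_eq_ite, h1] at h2
    split_ifs at h2 with h3
    · rwa [hsi] at h3
    · linarith
  have hacc : ∀ j i, payoff cap τ x y s j i = 1 - |x i - y j| → |x i - y j| ≤ r →
      i ∈ served cap τ x y s (s i) := by
    intro j i h1 h2
    have h3 := hs i j
    rw [payoff_eq_ite, h1] at h3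
    split_ifs at h3 with h4
    · exact h4
    · linarith
  set B := Finset.univ.filter fun i => |x i - y 0| + |x i - y 1| = 2 * r with hBdef
  have hfull : ∀ j, (served cap τ x y s j).card = cap j ∧
      ∀ i ∈ served cap τ x y s j, |x i - y j| ≤ r := by
    intro j
    obtain ⟨j', hjj⟩ : ∃ j', j ≠ j' := ⟨1 - j, by omega⟩
    have hcover : ∀ l : Fin 2, l = j ∨ l = j' := by omega
    by_contra hcon
    -- If `j` has a free place, or serves somebody beyond `r`, then any agent within `r` of `j` can
    -- get a place there.
    have hroom : ∀ i, |x i - y j| ≤ r → payoff cap τ x y s j i = 1 - |x i - y j| := by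
      intro i hi
      refine if_pos ?_
      by_cases hc : (served cap τ x y s j).card = cap j
      · obtain ⟨l, hl, hlr⟩ : ∃ l ∈ served cap τ x y s j, r < |x l - y j| := by
          by_contra! h
          exact hcon ⟨hc, h⟩
        refine lt_of_le_of_lt (Finset.card_le_card fun l' hl' => ?_) (mem_topSet.1 hl).2
        rw [Finset.mem_filter] at hl' ⊢
        exact ⟨hl'.1, Or.inl (by linarith [hl'.2.le])⟩
      · rw [served, card_topSet] at hc
        exact lt_of_le_of_lt (Finset.card_filter_le _ _) (by omega)
    have hBsum : ∀ i ∈ B, |x i - y j| + |x i - y j'| = 2 * r := fun i hi =>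
      (add_eq_zero_add_one (fun j => |x i - y j|) hjj).trans (Finset.mem_filter.1 hi).2
    have hBsub : B ⊆ served cap τ x y s j ∪ served cap τ x y s j' := by
      intro i hi
      have hi' := hBsum i hi
      rw [Finset.mem_union]
      rcases le_or_gt (|x i - y j|) r with h | h
      · have h1 := hacc j i (hroom i h) h
        rcases hcover (s i) with h2 | h2 <;> rw [h2] at h1
        · exact Or.inl h1
        · exact Or.inr h1
      · exact Or.inr (hclose j' i (by linarith))
    have hcapsum : cap j + cap j' = cap 0 + cap 1 := add_eq_zero_add_one cap hjj
    have hle := Finset.card_union_le (served cap τ x y s j) (served cap τ x y s j')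
    have h1 := card_served_le (cap := cap) (τ := τ) (x := x) (y := y) (s := s) j
    have h2 := card_served_le (cap := cap) (τ := τ) (x := x) (y := y) (s := s) j'
    have h3 := Finset.card_le_card hBsub
    -- All agents of `B` are served and `B` has at least as many agents as there are places: so both
    -- facilities are full and serve exactly `B`. An agent of `B` beyond `r` from `j` is closer than
    -- `r` to `j'` and thus served there.
    have hEq := Finset.eq_of_subset_of_card_le hBsub (by omega)
    refine hcon ⟨by omega, fun i hi => not_lt.1 fun hlt => ?_⟩
    have hiB : i ∈ B := hEq ▸ Finset.mem_union_left _ hi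
    have hi' := hBsum i hiB
    exact hjj ((mem_served hi).symm.trans (mem_served (hclose j' i (by linarith))))
  rw [socialWelfare_eq_sum_served]
  refine Finset.sum_congr rfl fun j _ => ?_
  rw [← Finset.sum_subset (Finset.subset_univ (served cap τ x y s j)), ← (hfull j).1,
    ← nsmul_eq_mul, ← Finset.sum_const, ← Finset.sum_add_distrib]
  · refine Finset.sum_congr rfl fun i hi => ?_
    rw [max_eq_right (by linarith [(hfull j).2 i hi])]
    ring
  · intro i _ hi
    exact max_eq_left (by linarith [not_lt.1 fun h => hi (hclose j i h)])

end TwoFacilities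

/-! ### Existence of equilibria and uniqueness of their welfare. -/

section EquilibriumWelfare

variable {n : ℕ} {cap : Fin 2 → ℕ} {τ : Fin 2 → Equiv.Perm (Fin n)} {x : Fin n → ℝ}
  {y : Fin 2 → ℝ} {s : Fin n → Fin 2}

open scoped Classical in
theorem le_of_mem_topSet {σ : Equiv.Perm (Fin n)} {z r : ℝ} {k : ℕ} {i : Fin n}
    (hk : k ≤ (Finset.univ.filter fun l => |x l - z| ≤ r).card)
    (hi : i ∈ topSet (Ahead σ x z) Finset.univ k) : |x i - z| ≤ r := by
  by_contra! h
  refine absurd (mem_topSet.1 hi).2 (not_lt.2 (hk.trans (Finset.card_le_card fun l hl => ?_)))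
  rw [Finset.mem_filter] at hl ⊢
  exact ⟨hl.1, Or.inl (by linarith [hl.2])⟩

open scoped Classical in
theorem lt_of_mem_topSet {σ : Equiv.Perm (Fin n)} {z r : ℝ} {k : ℕ} {i : Fin n}
    (hk : k ≤ (Finset.univ.filter fun l => |x l - z| < r).card)
    (hi : i ∈ topSet (Ahead σ x z) Finset.univ k) : |x i - z| < r := by
  by_contra! h
  refine absurd (mem_topSet.1 hi).2 (not_lt.2 (hk.trans (Finset.card_le_card fun l hl => ?_)))
  rw [Finset.mem_filter] at hl ⊢
  exact ⟨hl.1, Or.inl (by linarith [hl.2])⟩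

theorem two_mul_half_dist_le (x : Fin n → ℝ) (y : Fin 2 → ℝ) (i : Fin n) :
    2 * (|y 0 - y 1| / 2) ≤ |x i - y 0| + |x i - y 1| := by
  have := abs_sub_le (y 0) (x i) (y 1)
  rw [abs_sub_comm (y 0) (x i)] at this
  linarith

-- Each agent between the facilities is within half their distance of one of them. By counting, some
-- facility can be filled with agents that weakly prefer it, and `exists_isNash` applies.
open scoped Classical in
theorem exists_isNash_of_between (hd : ∀ i j, |x i - y j| ≤ 1) (hcap : ∀ j, cap j ≤ n)
    (hB : cap 0 + cap 1 ≤
      (Finset.univ.filter fun i => |x i - y 0| + |x i - y 1| = |y 0 - y 1|).card) :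
    ∃ s, IsNash cap τ x y s := by
  obtain ⟨j, hj⟩ : ∃ j, cap j ≤
      (Finset.univ.filter fun l => |x l - y j| ≤ |y 0 - y 1| / 2).card := by
    by_contra! h
    have hsub : (Finset.univ.filter fun i => |x i - y 0| + |x i - y 1| = |y 0 - y 1|) ⊆
        (Finset.univ.filter fun l => |x l - y 0| ≤ |y 0 - y 1| / 2) ∪
        (Finset.univ.filter fun l => |x l - y 1| ≤ |y 0 - y 1| / 2) := by
      intro i hi
      simp only [Finset.mem_union, Finset.mem_filter, Finset.mem_univ, true_and] at hi ⊢
      by_contra! hcon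
      linarith
    have h1 := (Finset.card_le_card hsub).trans (Finset.card_union_le _ _)
    have h2 := h 0
    have h3 := h 1
    omega
  obtain ⟨j', hjj⟩ : ∃ j', j ≠ j' := ⟨1 - j, by omega⟩
  refine exists_isNash hjj hd (hcap j) fun i hi => ?_
  have h1 := le_of_mem_topSet hj hi
  have h2 := two_mul_half_dist_le x y i
  rw [← add_eq_zero_add_one (fun j => |x i - y j|) hjj] at h2
  linarith

-- Either both facilities lack strictly closer agents (`socialWelfare_of_scarce`) or one can be
-- filled with them (`socialWelfare_of_preferred`); both formulas are free of the profile.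
open scoped Classical in
theorem nashWelfares_eq_singleton (hd : ∀ i j, |x i - y j| ≤ 1) (hy : |y 0 - y 1| ≤ 1)
    (hcap : ∀ j, cap j ≤ n)
    (hB : cap 0 + cap 1 ≤
      (Finset.univ.filter fun i => |x i - y 0| + |x i - y 1| = |y 0 - y 1|).card) :
    ∃ w, nashWelfares cap τ x y = {w} := by
  suffices h : ∃ w, ∀ s, IsNash cap τ x y s → socialWelfare cap τ x y s = w by
    obtain ⟨w, hw⟩ := h
    obtain ⟨s, hs⟩ := exists_isNash_of_between (τ := τ) hd hcap hB
    refine ⟨w, Set.eq_singleton_iff_unique_mem.2 ⟨⟨s, hs, (hw s hs).symm⟩, ?_⟩⟩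
    rintro _ ⟨t, ht, rfl⟩
    exact hw t ht
  by_cases h : ∀ j, (Finset.univ.filter fun i => |x i - y j| < |y 0 - y 1| / 2).card < cap j
  · refine ⟨_, fun s hs => socialWelfare_of_scarce hd (by linarith) (two_mul_half_dist_le x y) h
      ?_ hs⟩
    simpa only [mul_div_cancel₀ _ (two_ne_zero' ℝ)] using hB
  · push Not at h
    obtain ⟨j, hj⟩ := h
    obtain ⟨j', hjj⟩ : ∃ j', j ≠ j' := ⟨1 - j, by omega⟩
    refine ⟨_, fun s hs => socialWelfare_of_preferred hjj hd (hcap j) (fun i hi => ?_) hs⟩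
    have h1 := lt_of_mem_topSet hj hi
    have h2 := two_mul_half_dist_le x y i
    rw [← add_eq_zero_add_one (fun j => |x i - y j|) hjj] at h2
    linarith

open scoped Classical in
/-- An equilibrium is at least as good as serving agents `A j` at facility `j` if these are not among
the agents closest to the other facility. -/
theorem sum_le_socialWelfare (hd : ∀ i j, |x i - y j| ≤ 1) (hy : |y 0 - y 1| ≤ 1)
    (hcap : ∀ j, cap j ≤ n)
    (hB : cap 0 + cap 1 ≤
      (Finset.univ.filter fun i => |x i - y 0| + |x i - y 1| = |y 0 - y 1|).card)
    {A : Fin 2 → Finset (Fin n)} (hA : ∀ j, (A j).card ≤ cap j)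
    (hdisj : ∀ j j', j ≠ j' → ∀ i ∈ A j',
      i ∉ topSet (Ahead (τ j) x (y j)) Finset.univ (cap j))
    (hs : IsNash cap τ x y s) :
    ∑ j, ∑ i ∈ A j, (1 - |x i - y j|) ≤ socialWelfare cap τ x y s := by
  by_cases h : ∀ j, (Finset.univ.filter fun i => |x i - y j| < |y 0 - y 1| / 2).card < cap j
  · rw [socialWelfare_of_scarce hd (r := |y 0 - y 1| / 2) (by linarith) (two_mul_half_dist_le x y) h
      (by simpa only [mul_div_cancel₀ _ (two_ne_zero' ℝ)] using hB) hs]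
    -- In the scarce case the equilibrium welfare is the dual value at `ρ = r`, so weak duality
    -- compares it with any assignment.
    exact Finset.sum_le_sum fun j _ => sum_le_threshold (hA j) (by linarith) _
  · push Not at h
    obtain ⟨j, hj⟩ := h
    obtain ⟨j', hjj⟩ : ∃ j', j ≠ j' := ⟨1 - j, by omega⟩
    rw [socialWelfare_of_preferred hjj hd (hcap j) (fun i hi => ?_) hs, Fin.sum_univ_two,
      ← add_eq_zero_add_one (fun j => ∑ i ∈ A j, (1 - |x i - y j|)) hjj]
    · refine add_le_add ?_ ?_
      · exact sum_le_sum_topSet (fun i => by linarith [hd i j])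
          (fun i l hil => by linarith [hil.le]) (Finset.subset_univ _) (hA j)
      · exact sum_le_sum_topSet (fun i => by linarith [hd i j'])
          (fun i l hil => by linarith [hil.le])
          (fun i hi => Finset.mem_compl.2 (hdisj j j' hjj i hi)) (hA j')
    · have h1 := lt_of_mem_topSet hj hi
      have h2 := two_mul_half_dist_le x y i
      rw [← add_eq_zero_add_one (fun j => |x i - y j|) hjj] at h2
      linarith

end EquilibriumWelfare

/-! ### Agents sorted by position. -/

section OrderStatistics

variable {n : ℕ} {x : Fin n → ℝ}

theorem orderStat_of_lt {k : ℕ} (h : k < n) : orderStat x k = x (Tuple.sort x ⟨k, h⟩) := dif_pos h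

theorem orderStat_coe (i : Fin n) : orderStat x i = x (Tuple.sort x i) := orderStat_of_lt i.2

theorem orderStat_mono {k l : ℕ} (hkl : k ≤ l) (hl : l < n) : orderStat x k ≤ orderStat x l := by
  rw [orderStat_of_lt hl, orderStat_of_lt (hkl.trans_lt hl)]
  exact Tuple.monotone_sort x (Fin.mk_le_mk.2 hkl)

theorem orderStat_lt {k l : ℕ} (hx : Function.Injective x) (hkl : k < l) (hl : l < n) :
    orderStat x k < orderStat x l := by
  refine (orderStat_mono hkl.le hl).lt_of_ne fun h => ?_
  rw [orderStat_of_lt hl, orderStat_of_lt (hkl.trans hl)] at h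
  have := (Tuple.sort x).injective (hx h)
  simp only [Fin.mk.injEq] at this
  omega

theorem orderStat_mem (hx : ∀ i, x i ∈ Set.Icc (0 : ℝ) 1) (k : ℕ) :
    orderStat x k ∈ Set.Icc (0 : ℝ) 1 := by
  unfold orderStat
  split_ifs
  · exact hx _
  · simp

theorem sum_orderStat (g : ℝ → ℝ) : ∑ k ∈ Finset.range n, g (orderStat x k) = ∑ i, g (x i) := by
  rw [← Fin.sum_univ_eq_sum_range (fun k => g (orderStat x k)) n,
    ← Equiv.sum_comp (Tuple.sort x) (fun i => g (x i))]
  simp only [orderStat_coe]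

/-- The agents whose rank (from the left, starting at `0`) satisfies `P`. -/
noncomputable def agentsOfRank (x : Fin n → ℝ) (P : ℕ → Prop) [DecidablePred P] : Finset (Fin n) :=
  Finset.univ.filter fun i => P ((Tuple.sort x).symm i)

theorem sum_agentsOfRank (P : ℕ → Prop) [DecidablePred P] {M : Type*} [AddCommMonoid M]
    (g : Fin n → M) (g' : ℕ → M) (hg : ∀ I : Fin n, g (Tuple.sort x I) = g' I) :
    ∑ i ∈ agentsOfRank x P, g i = ∑ k ∈ (Finset.range n).filter P, g' k := by
  rw [agentsOfRank, Finset.sum_filter, Finset.sum_filter,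
    ← Equiv.sum_comp (Tuple.sort x), ← Fin.sum_univ_eq_sum_range (fun k => if P k then g' k else 0)]
  simp only [Equiv.symm_apply_apply, hg]

/-- If an agent is among the `k` closest ones to the agent of rank `M`, then its rank is close to
`M`. -/
theorem rank_lt_of_mem_topSet (hx : Function.Injective x) {σ : Equiv.Perm (Fin n)} {k M : ℕ}
    (hM : M < n) {P : Fin n}
    (hP : Tuple.sort x P ∈ topSet (Ahead σ x (orderStat x M)) Finset.univ k) :
    (P : ℕ) < M + k ∧ M < P + k := by
  classical
  have hcard : (topSet (Ahead σ x (orderStat x M)) Finset.univ k).card ≤ k := by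
    rw [card_topSet]
    exact min_le_left _ _
  have hmem : ∀ I : Fin n, |orderStat x I - orderStat x M| < |orderStat x P - orderStat x M| →
      Tuple.sort x I ∈ topSet (Ahead σ x (orderStat x M)) Finset.univ k := by
    intro I hI
    by_contra hcon
    have := (rel_of_mem_topSet hP (Finset.mem_univ _) hcon).le
    rw [← orderStat_coe (x := x), ← orderStat_coe (x := x)] at this
    linarith
  -- Applied to the ranks between `M` and `P`: as positions are distinct, these agents are strictly
  -- closer than `P`, so they all belong to the `k` closest.
  have hcount : ∀ S : Finset (Fin n),
      (∀ I ∈ S, I = P ∨ |orderStat x I - orderStat x M| < |orderStat x P - orderStat x M|) →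
      S.card ≤ k := by
    intro S hS
    rw [← Finset.card_image_of_injective S (Tuple.sort x).injective]
    refine (Finset.card_le_card fun i hi => ?_).trans hcard
    obtain ⟨I, hI, rfl⟩ := Finset.mem_image.1 hi
    rcases hS I hI with rfl | h
    · exact hP
    · exact hmem I h
  rcases le_total M P with h | h
  · have hc := hcount (Finset.Icc ⟨M, hM⟩ P) fun I hI => by
      rw [Finset.mem_Icc] at hI
      rcases eq_or_ne I P with h' | h'
      · exact Or.inl h'
      · have h1 : (I : ℕ) < P := lt_of_le_of_ne hI.2 (Fin.val_ne_of_ne h')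
        have h2 := orderStat_lt hx h1 P.2
        have h3 := orderStat_mono (x := x) (k := M) (l := I) hI.1 I.2
        right
        rw [abs_of_nonneg (by linarith), abs_of_nonneg (by linarith)]
        linarith
    rw [Fin.card_Icc] at hc
    simp only at hc
    omega
  · have hc := hcount (Finset.Icc P ⟨M, hM⟩) fun I hI => by
      rw [Finset.mem_Icc] at hI
      rcases eq_or_ne I P with h' | h'
      · exact Or.inl h'
      · have h1 : (P : ℕ) < I := lt_of_le_of_ne hI.1 (Fin.val_ne_of_ne h'.symm)
        have h2 := orderStat_lt hx h1 I.2
        have h3 := orderStat_mono (x := x) (k := I) (l := M) hI.2 hM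
        right
        rw [abs_of_nonpos (by linarith), abs_of_nonpos (by linarith)]
        linarith
    rw [Fin.card_Icc] at hc
    simp only at hc
    omega

theorem le_card_between {k M₀ M₁ : ℕ} (hk : k + M₀ ≤ M₁ + 1) (h₁ : M₁ < n) (h₀ : M₀ ≤ M₁) :
    k ≤ (Finset.univ.filter fun i => |x i - orderStat x M₀| + |x i - orderStat x M₁| =
      |orderStat x M₀ - orderStat x M₁|).card := by
  have hc : ((Finset.Icc (⟨M₀, h₀.trans_lt h₁⟩ : Fin n) ⟨M₁, h₁⟩).image (Tuple.sort x)).card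
      = M₁ + 1 - M₀ := by
    rw [Finset.card_image_of_injective _ (Tuple.sort x).injective, Fin.card_Icc]
  refine le_trans (by omega) (hc.symm.le.trans (Finset.card_le_card fun i hi => ?_))
  obtain ⟨I, hI, rfl⟩ := Finset.mem_image.1 hi
  rw [Finset.mem_Icc] at hI
  have h2 := orderStat_mono (x := x) (k := M₀) (l := I) hI.1 I.2
  have h3 := orderStat_mono (x := x) (k := I) (l := M₁) hI.2 h₁
  rw [Finset.mem_filter, ← orderStat_coe (x := x)]
  refine ⟨Finset.mem_univ _, ?_⟩
  rw [abs_of_nonneg (by linarith), abs_of_nonpos (by linarith), abs_of_nonpos (by linarith)]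
  ring

end OrderStatistics

/-! ### Distance sums of initial segments of a sorted sequence. -/

section SortedSequences

variable {n k M : ℕ} {z : ℕ → ℝ} {a b : ℝ}

theorem sum_range_ite_lt (k M : ℕ) :
    ∑ i ∈ Finset.range k, (if i < M then (-1 : ℝ) else 1) = k - 2 * (min k M : ℕ) := by
  induction k with
  | zero => simp
  | succ k ih =>
    rw [Finset.sum_range_succ, ih]
    split_ifs with h
    · rw [min_eq_left h.le, min_eq_left (by omega : k + 1 ≤ M)]
      push_cast
      ring
    · rw [min_eq_right (by omega : M ≤ k), min_eq_right (by omega : M ≤ k + 1)]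
      push_cast
      ring

/-- The sum of the distances to an almost median point is almost minimal. -/
theorem sum_abs_sub_median_le (hz : ∀ i l, i ≤ l → l < n → z i ≤ z l) (hk : k ≤ n) (hM : M < n)
    (h1 : k ≤ 2 * M + 5) (h2 : 2 * M ≤ k + 3) (hδ : |a - z M| ≤ 1) :
    ∑ i ∈ Finset.range k, |z i - z M| ≤ ∑ i ∈ Finset.range k, |z i - a| + 3 := by
  -- Replacing `a` by `z M` brings the facility nearer by `|a - z M|` to all points on one side of
  -- the median and farther by at most that on the other. Rank `M` counts on the side that gains,
  -- hence `M + 1` or `M`; the two sides differ by at most 3 points.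
  obtain ⟨M', e, hle, he⟩ : ∃ (M' : ℕ) (e : ℝ), (∀ i < k, |z i - z M| ≤ |z i - a| +
      (if i < M' then (-1 : ℝ) else 1) * e) ∧ (k - 2 * (min k M' : ℕ)) * e ≤ (3 : ℝ) := by
    rcases le_total (z M) a with ha | ha
    · refine ⟨M + 1, a - z M, fun i hi => ?_, ?_⟩
      · split_ifs with h
        · have := hz i M (by omega) hM
          rw [abs_of_nonpos (by linarith), abs_of_nonpos (by linarith)]
          linarith
        · have := abs_sub_le (z i) a (z M)
          rw [abs_of_nonneg (sub_nonneg.2 ha)] at this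
          linarith
      · rw [abs_of_nonneg (sub_nonneg.2 ha)] at hδ
        have : (k : ℝ) - 2 * (min k (M + 1) : ℕ) ≤ 3 := by
          have : k ≤ 3 + 2 * (min k (M + 1)) := by omega
          have : (k : ℝ) ≤ 3 + 2 * (min k (M + 1) : ℕ) := by exact_mod_cast this
          linarith
        nlinarith
    · refine ⟨M, a - z M, fun i hi => ?_, ?_⟩
      · split_ifs with h
        · have := abs_sub_le (z i) a (z M)
          rw [abs_of_nonpos (sub_nonpos.2 ha)] at this
          linarith
        · have := hz M i (by omega) (by omega)
          rw [abs_of_nonneg (by linarith), abs_of_nonneg (by linarith)]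
          linarith
      · rw [abs_of_nonpos (sub_nonpos.2 ha)] at hδ
        have : 2 * ((min k M : ℕ) : ℝ) - k ≤ 3 := by
          have : 2 * (min k M) ≤ k + 3 := by omega
          have : 2 * ((min k M : ℕ) : ℝ) ≤ k + 3 := by exact_mod_cast this
          linarith
        nlinarith
  calc ∑ i ∈ Finset.range k, |z i - z M|
      ≤ ∑ i ∈ Finset.range k, (|z i - a| + (if i < M' then (-1 : ℝ) else 1) * e) :=
        Finset.sum_le_sum fun i hi => hle i (Finset.mem_range.1 hi)
    _ = ∑ i ∈ Finset.range k, |z i - a| + (k - 2 * (min k M' : ℕ)) * e := by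
        rw [Finset.sum_add_distrib, ← Finset.sum_mul, sum_range_ite_lt]
    _ ≤ _ := by linarith

theorem sum_abs_sub_le_truncated (hz : ∀ i l, i ≤ l → l < n → z i ≤ z l) (hk : k ≤ n)
    (hδ : ∀ i < n, |z i - a| ≤ 1) :
    ∑ i ∈ Finset.range k, |z i - a| ≤ ∑ i ∈ Finset.range n, (if z i ≤ b then |z i - a| else 0) +
      max 0 (k - ∑ i ∈ Finset.range n, (if z i ≤ b then (1 : ℝ) else 0)) := by
  have hsub : Finset.range k ⊆ Finset.range n := Finset.range_subset_range.2 hk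
  have h1 : ∑ i ∈ Finset.range k, |z i - a| ≤ ∑ i ∈ Finset.range k,
      ((if z i ≤ b then |z i - a| else 0) + (1 - if z i ≤ b then (1 : ℝ) else 0)) := by
    refine Finset.sum_le_sum fun i hi => ?_
    have := hδ i (Finset.mem_range.1 (hsub hi))
    split_ifs <;> linarith
  have h2 : ∑ i ∈ Finset.range k, (if z i ≤ b then |z i - a| else 0) ≤
      ∑ i ∈ Finset.range n, (if z i ≤ b then |z i - a| else 0) := by
    refine Finset.sum_le_sum_of_subset_of_nonneg hsub fun i _ _ => ?_
    split_ifs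
    · exact abs_nonneg _
    · exact le_rfl
  -- If one of the first `k` points exceeds `b`, so do all points from rank `k` on, and the full
  -- indicator sum only counts among the first `k`.
  have h3 : ∑ i ∈ Finset.range k, (1 - if z i ≤ b then (1 : ℝ) else 0) ≤
      max 0 (k - ∑ i ∈ Finset.range n, (if z i ≤ b then (1 : ℝ) else 0)) := by
    by_cases h : ∀ i < k, z i ≤ b
    · refine le_max_of_le_left (Finset.sum_nonpos fun i hi => ?_)
      rw [if_pos (h i (Finset.mem_range.1 hi)), sub_self]
    · push Not at h
      obtain ⟨l, hl, hlb⟩ := h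
      refine le_max_of_le_right ?_
      rw [Finset.sum_sub_distrib, ← Finset.sum_subset hsub]
      · simp
      · intro i hi hi'
        rw [Finset.mem_range] at hi hi'
        exact if_neg (not_le.2 (hlb.trans_le (hz l i (by omega) hi)))
  rw [Finset.sum_add_distrib] at h1
  linarith

end SortedSequences

/-! ### The percentile mechanism: stability and a lower bound on its welfare. -/

section Percentile

variable {n : ℕ} {x : Fin n → ℝ} {q₁ q₂ : ℝ}

theorem capacity_le {m : ℕ} {q : Fin m → ℝ} {j : Fin m} (hq : 0 ≤ q j) :
    (capacity q n j : ℝ) ≤ q j * n := Nat.floor_le (by positivity)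

theorem lt_capacity_add_one {m : ℕ} (q : Fin m → ℝ) (j : Fin m) :
    q j * n < (capacity q n j : ℝ) + 1 := Nat.lt_floor_add_one _

theorem capacity_le_card (hq₁ : 0 ≤ q₁) (hq₂ : 0 ≤ q₂) (hq : q₁ + q₂ ≤ 2 / 3) (j : Fin 2) :
    capacity ![q₁, q₂] n j ≤ n := by
  have hn : (0 : ℝ) ≤ n := Nat.cast_nonneg n
  have hj : 0 ≤ ![q₁, q₂] j ∧ ![q₁, q₂] j ≤ 1 := by
    revert j
    rw [Fin.forall_fin_two]
    exact ⟨⟨hq₁, by simp; linarith⟩, ⟨hq₂, by simp; linarith⟩⟩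
  have h : (capacity ![q₁, q₂] n j : ℝ) ≤ n :=
    (capacity_le hj.1).trans (mul_le_of_le_one_left hn hj.2)
  exact_mod_cast h

/-- The ranks selected by the percentile mechanism are almost the medians of the leftmost and of the
rightmost agents that fit into the facilities, and sufficiently many agents are between them. -/
theorem percentile_ranks (hq₁ : 0 ≤ q₁) (hq₂ : 0 ≤ q₂) (hq : q₁ + q₂ ≤ 2 / 3) (hn : 0 < n)
    {M₀ M₁ k₀ k₁ : ℕ} (hM₀ : M₀ = ⌊q₁ / 2 * ((n : ℝ) - 1)⌋₊)
    (hM₁ : M₁ = ⌊(1 - q₂ / 2) * ((n : ℝ) - 1)⌋₊) (hk₀ : k₀ = capacity ![q₁, q₂] n 0)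
    (hk₁ : k₁ = capacity ![q₁, q₂] n 1) :
    M₀ ≤ M₁ ∧ M₁ < n ∧ k₀ + k₁ + M₀ ≤ M₁ + 1 ∧ k₀ ≤ 2 * M₀ + 5 ∧ 2 * M₀ ≤ k₀ + 3 ∧
      k₁ ≤ 2 * (n - 1 - M₁) + 5 ∧ 2 * (n - 1 - M₁) ≤ k₁ + 3 := by
  have hn' : (0 : ℝ) ≤ (n : ℝ) - 1 := by
    have : (1 : ℝ) ≤ n := by exact_mod_cast hn
    linarith
  have a1 : (M₀ : ℝ) ≤ q₁ / 2 * ((n : ℝ) - 1) := hM₀ ▸ Nat.floor_le (by positivity)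
  have a2 : q₁ / 2 * ((n : ℝ) - 1) < M₀ + 1 := hM₀ ▸ Nat.lt_floor_add_one _
  have b1 : (M₁ : ℝ) ≤ (1 - q₂ / 2) * ((n : ℝ) - 1) :=
    hM₁ ▸ Nat.floor_le (mul_nonneg (by linarith) hn')
  have b2 : (1 - q₂ / 2) * ((n : ℝ) - 1) < M₁ + 1 := hM₁ ▸ Nat.lt_floor_add_one _
  have c1 : (k₀ : ℝ) ≤ q₁ * n := hk₀ ▸ capacity_le (q := ![q₁, q₂]) (j := 0) hq₁
  have c2 : q₁ * n < k₀ + 1 := hk₀ ▸ lt_capacity_add_one ![q₁, q₂] 0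
  have d1 : (k₁ : ℝ) ≤ q₂ * n := hk₁ ▸ capacity_le (q := ![q₁, q₂]) (j := 1) hq₂
  have d2 : q₂ * n < k₁ + 1 := hk₁ ▸ lt_capacity_add_one ![q₁, q₂] 1
  have e1 : M₁ < n := by
    have : (M₁ : ℝ) < n := by nlinarith
    exact_mod_cast this
  -- This is where 2/3 is needed: to first order the claim is `q₁ + q₂ + q₁ / 2 ≤ 1 - q₂ / 2`.
  -- Integrality absorbs the rounding.
  have e2 : k₀ + k₁ + M₀ < M₁ + 2 := by
    have : (k₀ : ℝ) + k₁ + M₀ < M₁ + 2 := by nlinarith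
    exact_mod_cast this
  have e3 : M₀ < M₁ + 1 := by
    have : (M₀ : ℝ) < M₁ + 1 := by nlinarith
    exact_mod_cast this
  have e4 : k₀ ≤ 2 * M₀ + 5 := by
    have : (k₀ : ℝ) ≤ 2 * M₀ + 5 := by nlinarith
    exact_mod_cast this
  have e5 : 2 * M₀ ≤ k₀ + 3 := by
    have : 2 * (M₀ : ℝ) ≤ k₀ + 3 := by nlinarith
    exact_mod_cast this
  have e6 : k₁ + 2 * M₁ ≤ 2 * n + 3 := by
    have : (k₁ : ℝ) + 2 * M₁ ≤ 2 * n + 3 := by nlinarith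
    exact_mod_cast this
  have e7 : 2 * n ≤ k₁ + 5 + 2 * M₁ := by
    have : 2 * (n : ℝ) ≤ k₁ + 5 + 2 * M₁ := by nlinarith
    exact_mod_cast this
  omega

theorem percentile_zero (x : Fin n → ℝ) : percentileMechanism ![q₁ / 2, 1 - q₂ / 2] n x 0 =
    orderStat x ⌊q₁ / 2 * ((n : ℝ) - 1)⌋₊ := rfl

theorem percentile_one (x : Fin n → ℝ) : percentileMechanism ![q₁ / 2, 1 - q₂ / 2] n x 1 =
    orderStat x ⌊(1 - q₂ / 2) * ((n : ℝ) - 1)⌋₊ := rfl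

theorem abs_sub_le_one {s t : ℝ} (hs : s ∈ Set.Icc (0 : ℝ) 1) (ht : t ∈ Set.Icc (0 : ℝ) 1) :
    |s - t| ≤ 1 := by
  rw [abs_le]
  constructor <;> linarith [hs.1, hs.2, ht.1, ht.2]

theorem percentile_mem (hx : ∀ i, x i ∈ Set.Icc (0 : ℝ) 1) {p : Fin 2 → ℝ} (j : Fin 2) :
    percentileMechanism p n x j ∈ Set.Icc (0 : ℝ) 1 := orderStat_mem hx _

open scoped Classical in
theorem le_card_between_percentile (hq₁ : 0 ≤ q₁) (hq₂ : 0 ≤ q₂) (hq : q₁ + q₂ ≤ 2 / 3)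
    {y : Fin 2 → ℝ} (hy : y = percentileMechanism ![q₁ / 2, 1 - q₂ / 2] n x) :
    capacity ![q₁, q₂] n 0 + capacity ![q₁, q₂] n 1 ≤
      (Finset.univ.filter fun i => |x i - y 0| + |x i - y 1| = |y 0 - y 1|).card := by
  rcases n.eq_zero_or_pos with rfl | hn
  · simp [capacity]
  · obtain ⟨h1, h2, h3, -⟩ := percentile_ranks hq₁ hq₂ hq hn rfl rfl rfl rfl
    rw [hy, percentile_zero, percentile_one]
    convert le_card_between h3 h2 h1

theorem equilibriumStable_percentile (hq₁ : 0 ≤ q₁) (hq₂ : 0 ≤ q₂) (hq : q₁ + q₂ ≤ 2 / 3)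
    (τ : ∀ n : ℕ, Fin 2 → Equiv.Perm (Fin n)) :
    EquilibriumStable ![q₁, q₂] τ (percentileMechanism ![q₁ / 2, 1 - q₂ / 2]) := fun _ _ hx =>
  nashWelfares_eq_singleton (fun i j => abs_sub_le_one (hx i) (percentile_mem hx j))
    (abs_sub_le_one (percentile_mem hx 0) (percentile_mem hx 1))
    (capacity_le_card hq₁ hq₂ hq) (le_card_between_percentile hq₁ hq₂ hq rfl)

/-- The cost of serving an agent at `t` from a facility at `a` if it is to the left of `b`. -/
noncomputable def truncatedCost (a b t : ℝ) : ℝ := if t ≤ b then |t - a| else 0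

/-- The indicator function of `(-∞, b]`. -/
noncomputable def leftIndicator (b t : ℝ) : ℝ := if t ≤ b then 1 else 0

/-- Serving `k` consecutive extreme agents from an almost median one among them. -/
theorem le_sum_extreme {z : ℕ → ℝ} {k M : ℕ} (hz : ∀ i l, i ≤ l → l < n → z i ≤ z l)
    (hz' : ∀ i, z i ∈ Set.Icc (0 : ℝ) 1) (hk : k ≤ n) (hM : M < n)
    (h1 : k ≤ 2 * M + 5) (h2 : 2 * M ≤ k + 3) {a : ℝ} (ha : a ∈ Set.Icc (0 : ℝ) 1) (b : ℝ) :
    k - 3 - ∑ i ∈ Finset.range n, truncatedCost a b (z i) -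
      max 0 (k - ∑ i ∈ Finset.range n, leftIndicator b (z i)) ≤
      ∑ i ∈ Finset.range k, (1 - |z i - z M|) := by
  have h3 := sum_abs_sub_median_le hz hk hM h1 h2 (abs_sub_le_one ha (hz' M))
  have h4 := sum_abs_sub_le_truncated (b := b) hz hk fun i _ => abs_sub_le_one (hz' i) ha
  simp only [truncatedCost, leftIndicator]
  rw [Finset.sum_sub_distrib]
  simp only [Finset.sum_const, Finset.card_range, nsmul_eq_mul, mul_one]
  linarith

/-- Compares the equilibrium with serving the leftmost agents at facility 0 and the rightmost at
facility 1. The reflection `t ↦ 1 - t` reduces the second group to the first. -/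
theorem le_mechWelfare (hq₁ : 0 ≤ q₁) (hq₂ : 0 ≤ q₂) (hq : q₁ + q₂ ≤ 2 / 3)
    (τ : ∀ n : ℕ, Fin 2 → Equiv.Perm (Fin n)) (hn : 0 < n)
    (hx : ∀ i, x i ∈ Set.Icc (0 : ℝ) 1) (hinj : Function.Injective x)
    {a₁ a₂ : ℝ} (ha₁ : a₁ ∈ Set.Icc (0 : ℝ) 1) (ha₂ : a₂ ∈ Set.Icc (0 : ℝ) 1) (b₁ b₂ : ℝ) :
    (capacity ![q₁, q₂] n 0 - 3 - ∑ i, truncatedCost a₁ b₁ (x i) -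
      max 0 (capacity ![q₁, q₂] n 0 - ∑ i, leftIndicator b₁ (x i))) +
    (capacity ![q₁, q₂] n 1 - 3 - ∑ i, truncatedCost a₂ b₂ (1 - x i) -
      max 0 (capacity ![q₁, q₂] n 1 - ∑ i, leftIndicator b₂ (1 - x i))) ≤
      mechWelfare ![q₁, q₂] τ (percentileMechanism ![q₁ / 2, 1 - q₂ / 2]) n x := by
  classical
  set y := percentileMechanism ![q₁ / 2, 1 - q₂ / 2] n x with hy
  set k₀ := capacity ![q₁, q₂] n 0 with hk₀
  set k₁ := capacity ![q₁, q₂] n 1 with hk₁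
  set M₀ := ⌊q₁ / 2 * ((n : ℝ) - 1)⌋₊ with hM₀
  set M₁ := ⌊(1 - q₂ / 2) * ((n : ℝ) - 1)⌋₊ with hM₁
  obtain ⟨h1, h2, h3, h4, h5, h6, h7⟩ := percentile_ranks hq₁ hq₂ hq hn hM₀ hM₁ hk₀ hk₁
  have hcap := capacity_le_card (n := n) hq₁ hq₂ hq
  have hkn₀ : k₀ ≤ n := hcap 0
  have hkn₁ : k₁ ≤ n := hcap 1
  have hy0 : y 0 = orderStat x M₀ := rfl
  have hy1 : y 1 = orderStat x M₁ := rfl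
  have hd : ∀ i j, |x i - y j| ≤ 1 := fun i j => abs_sub_le_one (hx i) (percentile_mem hx j)
  have hyy : |y 0 - y 1| ≤ 1 := abs_sub_le_one (percentile_mem hx 0) (percentile_mem hx 1)
  have hB := le_card_between_percentile hq₁ hq₂ hq hy
  obtain ⟨w, hw⟩ := equilibriumStable_percentile hq₁ hq₂ hq τ n x hx
  have hmech : mechWelfare ![q₁, q₂] τ (percentileMechanism ![q₁ / 2, 1 - q₂ / 2]) n x = w := by
    rw [mechWelfare, hw, csInf_singleton]
  obtain ⟨s, hs, hsw⟩ : w ∈ nashWelfares (capacity ![q₁, q₂] n) (τ n) x y := hw ▸ rfl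
  let A : Fin 2 → Finset (Fin n) :=
    ![agentsOfRank x fun k => k < k₀, agentsOfRank x fun k => n ≤ k + k₁]
  have hA0 : A 0 = agentsOfRank x fun k => k < k₀ := rfl
  have hA1 : A 1 = agentsOfRank x fun k => n ≤ k + k₁ := rfl
  have hfilter₀ : (Finset.range n).filter (fun k => k < k₀) = Finset.range k₀ := by
    ext k
    simp only [Finset.mem_filter, Finset.mem_range]
    omega
  have hfilter₁ : (Finset.range n).filter (fun k => n ≤ k + k₁) = Finset.Ico (n - k₁) n := by
    ext k
    simp only [Finset.mem_filter, Finset.mem_range, Finset.mem_Ico]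
    omega
  have hAcard : ∀ j, (A j).card ≤ capacity ![q₁, q₂] n j := by
    rw [Fin.forall_fin_two]
    constructor
    · rw [hA0, Finset.card_eq_sum_ones, sum_agentsOfRank (g' := fun _ => 1) _ _ fun _ => rfl,
        hfilter₀, ← Finset.card_eq_sum_ones, Finset.card_range]
    · rw [hA1, Finset.card_eq_sum_ones, sum_agentsOfRank (g' := fun _ => 1) _ _ fun _ => rfl,
        hfilter₁, ← Finset.card_eq_sum_ones, Nat.card_Ico, ← hk₁]
      omega
  -- A facility's closest agents differ in rank from it by less than its capacity, and the many
  -- agents in between keep them away from the extreme agents of the other side.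
  have hdisj : ∀ j j', j ≠ j' → ∀ i ∈ A j',
      i ∉ topSet (Ahead (τ n j) x (y j)) Finset.univ (capacity ![q₁, q₂] n j) := by
    intro j j' hjj i hi hcon
    obtain ⟨I, rfl⟩ := (Tuple.sort x).surjective i
    have hI := I.2
    obtain ⟨rfl, rfl⟩ | ⟨rfl, rfl⟩ : (j = 0 ∧ j' = 1) ∨ (j = 1 ∧ j' = 0) := by omega
    · simp only [hA1, agentsOfRank, Finset.mem_filter, Equiv.symm_apply_apply] at hi
      rw [hy0] at hcon
      have := rank_lt_of_mem_topSet hinj (by omega) hcon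
      omega
    · simp only [hA0, agentsOfRank, Finset.mem_filter, Equiv.symm_apply_apply] at hi
      rw [hy1] at hcon
      have := rank_lt_of_mem_topSet hinj h2 hcon
      omega
  have hmain := sum_le_socialWelfare hd hyy hcap hB hAcard hdisj hs
  rw [hmech, hsw]
  refine le_trans ?_ hmain
  rw [Fin.sum_univ_two]
  have hz := orderStat_mem hx
  refine add_le_add ?_ ?_
  · rw [hA0, sum_agentsOfRank (g' := fun k => 1 - |orderStat x k - orderStat x M₀|) _ _
      (fun I => by rw [orderStat_coe, hy0]), hfilter₀,
      ← sum_orderStat (x := x) (fun t => truncatedCost a₁ b₁ t),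
      ← sum_orderStat (x := x) (fun t => leftIndicator b₁ t)]
    exact le_sum_extreme (fun i l hil hl => orderStat_mono hil hl) hz hkn₀ (by omega) h4 h5 ha₁ b₁
  · have hrefl : ∀ g : ℝ → ℝ, ∑ i, g (1 - x i) =
        ∑ i ∈ Finset.range n, g (1 - orderStat x (n - 1 - i)) := by
      intro g
      rw [← sum_orderStat (x := x) (fun t => g (1 - t)),
        ← Finset.sum_range_reflect (fun k => g (1 - orderStat x k))]
    have hsum : ∑ i ∈ A 1, (1 - |x i - y 1|) = ∑ i ∈ Finset.range k₁,
        (1 - |(1 - orderStat x (n - 1 - i)) - (1 - orderStat x (n - 1 - (n - 1 - M₁)))|) := by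
      rw [hA1, sum_agentsOfRank (g' := fun k => 1 - |orderStat x k - orderStat x M₁|) _ _
        (fun I => by rw [orderStat_coe, hy1]), Finset.sum_filter,
        ← Finset.sum_range_reflect, show n - 1 - (n - 1 - M₁) = M₁ by omega]
      have : (Finset.range n).filter (fun k => k < k₁) = Finset.range k₁ := by
        ext k
        simp only [Finset.mem_filter, Finset.mem_range]
        omega
      rw [← this, Finset.sum_filter]
      refine Finset.sum_congr rfl fun i hi => ?_
      rw [Finset.mem_range] at hi
      refine if_congr (by omega) ?_ rfl
      rw [sub_sub_sub_cancel_left, abs_sub_comm]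
    rw [hsum, hrefl, hrefl]
    refine le_sum_extreme (z := fun k => 1 - orderStat x (n - 1 - k)) (M := n - 1 - M₁)
      (fun i l hil hl => ?_) (fun k => ?_) hkn₁ (by omega) h6 h7 ha₂ b₂
    · have := orderStat_mono (x := x) (k := n - 1 - l) (l := n - 1 - i) (by omega) (by omega)
      linarith
    · have := hz (n - 1 - k)
      exact ⟨by linarith [this.2], by linarith [this.1]⟩

/-- The optimal welfare dominates the welfare of an equilibrium stable mechanism. -/
theorem mechWelfare_le_optWelfare {m : ℕ} {q : Fin m → ℝ}
    {τ : ∀ n : ℕ, Fin m → Equiv.Perm (Fin n)} {M : Mechanism m} (hM : EquilibriumStable q τ M)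
    (hx : ∀ i, x i ∈ Set.Icc (0 : ℝ) 1) :
    mechWelfare q τ M n x ≤ optWelfare (capacity q n) (τ n) x := by
  obtain ⟨w, hw⟩ := hM n x hx
  rw [mechWelfare, hw, csInf_singleton]
  -- The dual bound at `ρ = 0` is the number of places; it makes the supremum a genuine one.
  refine le_csSup ⟨∑ j, (capacity q n j : ℝ), ?_⟩ ⟨M n x, hw ▸ rfl⟩
  rintro _ ⟨y, s, -, rfl⟩
  refine (socialWelfare_le (ρ := fun _ => 0) fun _ => zero_le_one).trans_eq ?_
  refine Finset.sum_congr rfl fun j _ => ?_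
  rw [Finset.sum_eq_zero fun i _ => max_eq_left (by linarith [abs_nonneg (x i - y j)])]
  ring

/-- The stable mechanism only serves to show that the set of attainable welfares is nonempty. -/
theorem optWelfare_le {m : ℕ} {q : Fin m → ℝ} {τ : ∀ n : ℕ, Fin m → Equiv.Perm (Fin n)}
    {M : Mechanism m} (hM : EquilibriumStable q τ M) (hx : ∀ i, x i ∈ Set.Icc (0 : ℝ) 1) {B : ℝ}
    (hB : ∀ y : Fin m → ℝ, ∃ ρ : Fin m → ℝ, (∀ j, ρ j ≤ 1) ∧
      ∑ j, (capacity q n j * (1 - ρ j) + ∑ i, max 0 (ρ j - |x i - y j|)) ≤ B) :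
    optWelfare (capacity q n) (τ n) x ≤ B := by
  obtain ⟨w, hw⟩ := hM n x hx
  refine csSup_le ⟨w, M n x, hw ▸ rfl⟩ ?_
  rintro _ ⟨y, s, -, rfl⟩
  obtain ⟨ρ, hρ, h⟩ := hB y
  exact (socialWelfare_le hρ).trans h

end Percentile

/-! ### Independent samples and their deviations. -/

section Sampling

variable {μ : Measure ℝ} {n : ℕ} {g : ℝ → ℝ}

/-- The deviation of the sum of `g` over a sample from its expectation. -/
noncomputable def deviation (μ : Measure ℝ) (g : ℝ → ℝ) (n : ℕ) (x : Fin n → ℝ) : ℝ :=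
  |∑ i, g (x i) - n * ∫ t, g t ∂μ|

theorem measurable_deviation (hg : Measurable g) : Measurable (deviation μ g n) := by
  unfold deviation
  fun_prop

variable [IsProbabilityMeasure μ]

theorem ae_forall_of_ae {P : ℝ → Prop} (h : ∀ᵐ t ∂μ, P t) :
    ∀ᵐ x ∂(Measure.pi fun _ : Fin n => μ), ∀ i, P (x i) := by
  rw [ae_all_iff]
  exact fun i => (measurePreserving_eval (fun _ : Fin n => μ) i).quasiMeasurePreserving.ae h

/-- Two coordinates have the joint law `μ.prod μ`, for which the diagonal is null as `μ` has no
atoms. -/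
theorem ae_injective [NullSingletonClass μ] :
    ∀ᵐ x ∂(Measure.pi fun _ : Fin n => μ), Function.Injective x := by
  have h : ∀ i j : Fin n, i ≠ j → ∀ᵐ x ∂(Measure.pi fun _ : Fin n => μ), x i ≠ x j := by
    intro i j hij
    have hind : ProbabilityTheory.IndepFun (fun x : Fin n → ℝ => x i) (fun x : Fin n → ℝ => x j)
        (Measure.pi fun _ : Fin n => μ) :=
      (ProbabilityTheory.iIndepFun_pi (X := fun _ : Fin n => (id : ℝ → ℝ)) (μ := fun _ => μ)
        fun _ => aemeasurable_id).indepFun hij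
    rw [ProbabilityTheory.indepFun_iff_map_prod_eq_prod_map_map
      (measurable_pi_apply i).aemeasurable (measurable_pi_apply j).aemeasurable,
      (measurePreserving_eval (fun _ : Fin n => μ) i).map_eq,
      (measurePreserving_eval (fun _ : Fin n => μ) j).map_eq] at hind
    have hdiag : (μ.prod μ) {p : ℝ × ℝ | p.1 = p.2} = 0 := by
      rw [Measure.measure_prod_null (measurableSet_eq_fun measurable_fst measurable_snd)]
      refine Eventually.of_forall fun t => ?_
      have : Prod.mk t ⁻¹' {p : ℝ × ℝ | p.1 = p.2} = {t} := by
        ext u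
        simp [eq_comm]
      change μ (Prod.mk t ⁻¹' {p : ℝ × ℝ | p.1 = p.2}) = 0
      rw [this]
      exact measure_singleton t
    rw [← hind, Measure.map_apply (by fun_prop)
      (measurableSet_eq_fun measurable_fst measurable_snd)] at hdiag
    rw [ae_iff]
    simpa using hdiag
  have h' : ∀ᵐ x ∂(Measure.pi fun _ : Fin n => μ), ∀ i j : Fin n, i ≠ j → x i ≠ x j := by
    simp only [ae_all_iff]
    exact h
  filter_upwards [h'] with x hx i j hij
  by_contra hne
  exact hx i j hne hij

/-- By Chebyshev's inequality the mean deviation of a sum of `n` bounded terms is at most `√n`. -/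
theorem lintegral_deviation_le (hg : Measurable g) (hg' : ∀ᵐ t ∂μ, g t ∈ Set.Icc (0 : ℝ) 1)
    (hn : 0 < n) :
    ∫⁻ x, ENNReal.ofReal (deviation μ g n x) ∂(Measure.pi fun _ : Fin n => μ) ≤
      ENNReal.ofReal (√n) := by
  set P := Measure.pi fun _ : Fin n => μ with hP
  have hL : MemLp g 2 μ := memLp_of_bounded hg' hg.aestronglyMeasurable 2
  have hev : ∀ i : Fin n, MeasurePreserving (fun x : Fin n → ℝ => x i) P μ :=
    measurePreserving_eval (fun _ : Fin n => μ)
  set S : (Fin n → ℝ) → ℝ := ∑ i, fun x => g (x i) with hS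
  have hLS : MemLp S 2 P := memLp_finsetSum' _ fun i _ => hL.comp_measurePreserving (hev i)
  have hES : ∫ x, S x ∂P = n * ∫ t, g t ∂μ := by
    simp only [hS, Finset.sum_apply]
    have hint : ∀ i : Fin n, Integrable (fun x : Fin n → ℝ => g (x i)) P := fun i =>
      (hL.comp_measurePreserving (hev i)).integrable (by norm_num)
    rw [integral_finsetSum _ fun i _ => hint i]
    have : ∀ i : Fin n, ∫ x, g (x i) ∂P = ∫ t, g t ∂μ := fun i => by
      rw [← (hev i).map_eq, integral_map (hev i).measurable.aemeasurable
        hg.aestronglyMeasurable]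
    simp [this]
  have hvar : ∫ x, (S x - n * ∫ t, g t ∂μ) ^ 2 ∂P ≤ n := by
    rw [← hES, ← ProbabilityTheory.variance_eq_integral hLS.aestronglyMeasurable.aemeasurable, hS,
      ProbabilityTheory.variance_sum_pi (X := fun _ => g) fun _ => hL]
    have := ProbabilityTheory.variance_le_sq_of_bounded hg' hg.aemeasurable
    simp only [Finset.sum_const, Finset.card_univ, Fintype.card_fin, nsmul_eq_mul]
    have hn0 : (0 : ℝ) ≤ n := Nat.cast_nonneg n
    nlinarith
  have hdev : ∀ x, deviation μ g n x = |S x - n * ∫ t, g t ∂μ| := fun x => by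
    simp [deviation, hS, Finset.sum_apply]
  have hsqrt : 0 < √(n : ℝ) := Real.sqrt_pos.2 (by exact_mod_cast hn)
  have hsq : √(n : ℝ) * √n = n := Real.mul_self_sqrt (Nat.cast_nonneg n)
  have hint2 : Integrable (fun x => (S x - n * ∫ t, g t ∂μ) ^ 2) P :=
    (hLS.sub (memLp_const _)).integrable_sq
  have hint : Integrable (deviation μ g n) P := by
    simp only [funext hdev]
    exact ((hLS.sub (memLp_const _)).integrable (by norm_num)).abs
  rw [← ofReal_integral_eq_lintegral_ofReal hint (Eventually.of_forall fun x => abs_nonneg _)]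
  refine ENNReal.ofReal_le_ofReal ?_
  -- The inequality `D ≤ D² / (2√n) + √n / 2` turns the variance bound `n` into a bound on the first
  -- moment.
  have hle : ∀ x, deviation μ g n x ≤
      (2 * √n)⁻¹ * ((S x - n * ∫ t, g t ∂μ) ^ 2) + √n / 2 := fun x => by
    rw [hdev, ← sq_abs]
    set D := |S x - n * ∫ t, g t ∂μ|
    have : (2 * √(n : ℝ))⁻¹ * D ^ 2 + √n / 2 - D = (2 * √(n : ℝ))⁻¹ * (D - √n) ^ 2 := by
      field_simp
      ring
    have h0 : 0 ≤ (2 * √(n : ℝ))⁻¹ * (D - √n) ^ 2 := by positivity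
    linarith
  calc ∫ x, deviation μ g n x ∂P
      ≤ ∫ x, ((2 * √n)⁻¹ * ((S x - n * ∫ t, g t ∂μ) ^ 2) + √n / 2) ∂P :=
        integral_mono hint ((hint2.const_mul _).add (integrable_const _)) hle
    _ = (2 * √n)⁻¹ * (∫ x, (S x - n * ∫ t, g t ∂μ) ^ 2 ∂P) + √n / 2 := by
        rw [integral_add (hint2.const_mul _) (integrable_const _), integral_const_mul]
        simp
    _ ≤ (2 * √n)⁻¹ * n + √n / 2 := by gcongr
    _ = √n := by
        field_simp
        nlinarith

end Sampling

/-! ### Quantiles and the optimality of extreme windows. -/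

/-- The properties of the distribution function of a symmetric single-dipped law on `[0,1]`. -/
structure IsDippedCDF (F : ℝ → ℝ) : Prop where
  mono : Monotone F
  continuous : Continuous F
  zero : F 0 = 0
  one : F 1 = 1
  symm : ∀ t, F (1 - t) = 1 - F t
  -- The only trace of single-dippedness: moving an interval right does not increase its mass while
  -- its new right end is at least as far from 1 as the old one is from 0.
  translate : ∀ α' α l : ℝ, 0 ≤ α' → α' ≤ α → 0 ≤ l → 2 * α + l ≤ 1 →
    F (α + l) - F (α' + l) ≤ F α - F α'

/-- The quantile function of a distribution function that is carried by `[0,1]`. -/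
noncomputable def quantile (F : ℝ → ℝ) (u : ℝ) : ℝ := sInf {t ∈ Set.Icc (0 : ℝ) 1 | u ≤ F t}

section Quantile

variable {F : ℝ → ℝ} (hF : IsDippedCDF F)

include hF

theorem isLeast_quantile {u : ℝ} (hu : u ≤ 1) :
    IsLeast {t ∈ Set.Icc (0 : ℝ) 1 | u ≤ F t} (quantile F u) := by
  have hc : IsCompact {t ∈ Set.Icc (0 : ℝ) 1 | u ≤ F t} :=
    isCompact_Icc.inter_right (isClosed_le continuous_const hF.continuous)
  exact hc.isLeast_sInf ⟨1, by simp [hF.one, hu]⟩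

theorem quantile_mem {u : ℝ} (hu : u ≤ 1) : quantile F u ∈ Set.Icc (0 : ℝ) 1 :=
  (isLeast_quantile hF hu).1.1

theorem quantile_le_iff {u t : ℝ} (hu0 : 0 < u) (hu : u ≤ 1) : quantile F u ≤ t ↔ u ≤ F t := by
  have h := isLeast_quantile hF hu
  constructor
  · intro hle
    exact h.1.2.trans (hF.mono hle)
  · intro hle
    rcases le_or_gt t 1 with ht | ht
    · have ht0 : 0 ≤ t := by
        by_contra! hneg
        linarith [hF.mono hneg.le, hF.zero]
      exact h.2 ⟨⟨ht0, ht⟩, hle⟩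
    · exact h.1.1.2.trans ht.le

theorem apply_quantile {u : ℝ} (hu0 : 0 < u) (hu : u ≤ 1) : F (quantile F u) = u := by
  have hQ := quantile_mem hF hu
  have hle := (quantile_le_iff hF hu0 hu).1 le_rfl
  obtain ⟨t, ht, hFt⟩ := intermediate_value_Icc hQ.1 hF.continuous.continuousOn
    (show u ∈ Set.Icc (F 0) (F (quantile F u)) from ⟨by linarith [hF.zero], hle⟩)
  rwa [← le_antisymm ht.2 ((quantile_le_iff hF hu0 hu).2 hFt.ge)]

theorem monotoneOn_quantile : MonotoneOn (quantile F) (Set.Iic 1) := by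
  intro u hu v hv huv
  have h := (isLeast_quantile hF hv).1
  exact (isLeast_quantile hF hu).2 ⟨h.1, huv.trans h.2⟩

/-- Among the windows of mass `2 * s` that leave mass at least `κ - s` on both sides, the shortest
ones are extreme. -/
theorem quantile_sub_le {κ s α β : ℝ} (hs : 0 < s) (hκ : s < κ) (hκ' : κ + s ≤ 1)
    (hαβ : α + β ≤ 1) (hκα : κ - s ≤ F α) (hmass : 2 * s ≤ F β - F α) :
    quantile F (κ + s) - quantile F (κ - s) ≤ β - α := by
  have h1 : quantile F (κ - s) ≤ α := (quantile_le_iff hF (by linarith) (by linarith)).2 hκα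
  have h2 : α ≤ β := by
    by_contra! h
    linarith [hF.mono h.le]
  have h3 := quantile_mem hF (u := κ - s) (by linarith)
  -- The window slides left to start at `quantile F (κ - s)`: the strip gained on the left outweighs
  -- the strip lost on the right.
  have h4 := hF.translate (quantile F (κ - s)) α (β - α) h3.1 h1 (by linarith) (by linarith)
  rw [apply_quantile hF (by linarith) (by linarith), add_sub_cancel] at h4
  have h5 : quantile F (κ + s) ≤ quantile F (κ - s) + (β - α) :=
    (quantile_le_iff hF (by linarith) hκ').2 (by linarith)
  linarith

/-- A window centred to the right of 1/2 is first reflected, so that `quantile_sub_le` can slide it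
to the left. -/
theorem quantile_sub_le_quantile_sub {κ s c : ℝ} (hs : 0 < s) (hκ : s < κ) (h1 : κ ≤ c)
    (h2 : c ≤ 1 - κ) :
    quantile F (κ + s) - quantile F (κ - s) ≤ quantile F (c + s) - quantile F (c - s) := by
  have hFβ := apply_quantile hF (u := c + s) (by linarith) (by linarith)
  have hFα := apply_quantile hF (u := c - s) (by linarith) (by linarith)
  rcases le_total (quantile F (c - s) + quantile F (c + s)) 1 with h | h
  · exact quantile_sub_le hF hs hκ (by linarith) h (by linarith) (by linarith)
  · have h3 := hF.symm (quantile F (c + s))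
    have h4 := hF.symm (quantile F (c - s))
    have := quantile_sub_le hF (α := 1 - quantile F (c + s)) (β := 1 - quantile F (c - s)) hs hκ
      (by linarith) (by linarith) (by linarith) (by linarith)
    linarith

theorem intervalIntegrable_quantile {p r : ℝ} (hp : p ≤ 1) (hr : r ≤ 1) :
    IntervalIntegrable (quantile F) volume p r :=
  ((monotoneOn_quantile hF).mono fun u hu => by
    rw [Set.mem_uIcc] at hu
    rcases hu with hu | hu
    · exact hu.2.trans hr
    · exact hu.2.trans hp).intervalIntegrable

/-- Folding at the centre pairs the levels `c ± s`. Each pair costs at least the length between its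
quantiles, with equality when `z` lies between them. -/
theorem integral_abs_quantile_sub {c δ : ℝ} (hδ : 0 ≤ δ) (hc : c + δ ≤ 1) (z : ℝ) :
    IntervalIntegrable (fun s => |quantile F (c + s) - z| + |quantile F (c - s) - z|) volume 0 δ ∧
    ∫ u in (c - δ)..(c + δ), |quantile F u - z| =
      ∫ s in (0)..δ, (|quantile F (c + s) - z| + |quantile F (c - s) - z|) := by
  have hint : ∀ {p r : ℝ}, p ≤ 1 → r ≤ 1 →
      IntervalIntegrable (fun u => |quantile F u - z|) volume p r := fun hp hr =>
    ((intervalIntegrable_quantile hF hp hr).sub intervalIntegrable_const).abs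
  have h1 : IntervalIntegrable (fun s => |quantile F (c + s) - z|) volume 0 δ := by
    refine (IntervalIntegrable.sub (MonotoneOn.intervalIntegrable fun u hu v hv huv => ?_)
      intervalIntegrable_const).abs
    rw [Set.uIcc_of_le hδ] at hu hv
    exact monotoneOn_quantile hF (Set.mem_Iic.2 (by linarith [hu.2]))
      (Set.mem_Iic.2 (by linarith [hv.2])) (by linarith)
  have h2 : IntervalIntegrable (fun s => |quantile F (c - s) - z|) volume 0 δ := by
    refine (IntervalIntegrable.sub (AntitoneOn.intervalIntegrable fun u hu v hv huv => ?_)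
      intervalIntegrable_const).abs
    rw [Set.uIcc_of_le hδ] at hu hv
    exact monotoneOn_quantile hF (Set.mem_Iic.2 (by linarith [hv.1]))
      (Set.mem_Iic.2 (by linarith [hu.1])) (by linarith)
  refine ⟨h1.add h2, ?_⟩
  rw [intervalIntegral.integral_add h1 h2,
    intervalIntegral.integral_comp_add_left (fun u => |quantile F u - z|),
    intervalIntegral.integral_comp_sub_left (fun u => |quantile F u - z|), add_zero, sub_zero,
    add_comm (∫ u in c..(c + δ), |quantile F u - z|),
    intervalIntegral.integral_add_adjacent_intervals (hint (by linarith) (by linarith))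
      (hint (by linarith) (by linarith))]

/-- The extreme window of mass `q` has the smallest cost among all windows of that mass. -/
theorem integral_extreme_window_le {q a c : ℝ} (hq : 0 ≤ q) (ha : F a = q / 2)
    (h1 : q / 2 ≤ c) (h2 : c ≤ 1 - q / 2) (z : ℝ) :
    ∫ u in (0)..q, |quantile F u - a| ≤ ∫ u in (c - q / 2)..(c + q / 2), |quantile F u - z| := by
  have e1 := integral_abs_quantile_sub hF (c := q / 2) (δ := q / 2) (by linarith) (by linarith) a
  have e2 := integral_abs_quantile_sub hF (c := c) (δ := q / 2) (by linarith) (by linarith) z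
  rw [sub_self, add_halves] at e1
  rw [e1.2, e2.2]
  refine intervalIntegral.integral_mono_on_of_le_Ioo (by linarith) e1.1 e2.1 fun s hs => ?_
  have h3 := quantile_sub_le_quantile_sub hF hs.1 hs.2 h1 h2
  have h4 : quantile F (q / 2 - s) ≤ a :=
    (quantile_le_iff hF (by linarith [hs.2]) (by linarith [hs.1])).2 (by linarith [hs.1])
  have h5 : a ≤ quantile F (q / 2 + s) := by
    by_contra! h
    have := (quantile_le_iff hF (by linarith [hs.1]) (by linarith [hs.2])).1 h.le
    linarith [hs.1]
  rw [abs_of_nonneg (sub_nonneg.2 h5), abs_of_nonpos (sub_nonpos.2 h4)]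
  have h6 := le_abs_self (quantile F (c + s) - z)
  have h7 := neg_abs_le (quantile F (c - s) - z)
  linarith

/-- Paired quantiles are at most 1 apart. This keeps the limit welfare positive, as the ratio
requires. -/
theorem integral_extreme_window_le_half {q a : ℝ} (hq : 0 ≤ q) (hq1 : q ≤ 1) (ha : F a = q / 2) :
    ∫ u in (0)..q, |quantile F u - a| ≤ q / 2 := by
  have e1 := integral_abs_quantile_sub hF (c := q / 2) (δ := q / 2) (by linarith) (by linarith) a
  rw [sub_self, add_halves] at e1
  rw [e1.2]
  refine le_trans (b := ∫ s in (0)..(q / 2), (1 : ℝ)) ?_ (by simp)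
  refine intervalIntegral.integral_mono_on_of_le_Ioo (by linarith) e1.1
    intervalIntegrable_const fun s hs => ?_
  have h4 : quantile F (q / 2 - s) ≤ a :=
    (quantile_le_iff hF (by linarith [hs.2]) (by linarith [hs.1])).2 (by linarith [hs.1])
  have h5 : a ≤ quantile F (q / 2 + s) := by
    by_contra! h
    have := (quantile_le_iff hF (by linarith [hs.1]) (by linarith [hs.2])).1 h.le
    linarith [hs.1]
  rw [abs_of_nonneg (sub_nonneg.2 h5), abs_of_nonpos (sub_nonpos.2 h4)]
  have h6 := quantile_mem hF (u := q / 2 - s) (by linarith [hs.1])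
  have h7 := quantile_mem hF (u := q / 2 + s) (by linarith [hs.2])
  linarith [h6.1, h7.2]

theorem eq_map_quantile {μ : Measure ℝ} [IsProbabilityMeasure μ]
    (hμ : ∀ t, μ.real (Set.Iic t) = F t) :
    AEMeasurable (quantile F) (volume.restrict (Set.Ioc 0 1)) ∧
      (volume.restrict (Set.Ioc (0 : ℝ) 1)).map (quantile F) = μ := by
  have hmeas : AEMeasurable (quantile F) (volume.restrict (Set.Ioc 0 1)) :=
    aemeasurable_restrict_of_monotoneOn measurableSet_Ioc
      ((monotoneOn_quantile hF).mono fun u hu => hu.2)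
  refine ⟨hmeas, ?_⟩
  have : IsFiniteMeasure ((volume.restrict (Set.Ioc (0 : ℝ) 1)).map (quantile F)) :=
    Measure.isFiniteMeasure_map _ _
  refine Measure.ext_of_Iic _ _ fun t => ?_
  rw [Measure.map_apply_of_aemeasurable hmeas measurableSet_Iic,
    Measure.restrict_apply' measurableSet_Ioc]
  have h1 : F t ≤ 1 := by
    rw [← hμ]
    exact measureReal_le_one
  have : quantile F ⁻¹' Set.Iic t ∩ Set.Ioc 0 1 = Set.Ioc 0 (F t) := by
    ext u
    simp only [Set.mem_inter_iff, Set.mem_preimage, Set.mem_Iic, Set.mem_Ioc]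
    constructor
    · rintro ⟨h, h0, h1⟩
      exact ⟨h0, (quantile_le_iff hF h0 h1).1 h⟩
    · rintro ⟨h0, h⟩
      exact ⟨(quantile_le_iff hF h0 (h.trans h1)).2 h, h0, h.trans h1⟩
  rw [this, Real.volume_Ioc, sub_zero, ← hμ, ofReal_measureReal]

theorem integral_eq_integral_quantile {μ : Measure ℝ} [IsProbabilityMeasure μ]
    (hμ : ∀ t, μ.real (Set.Iic t) = F t) {g : ℝ → ℝ} (hg : Measurable g) :
    ∫ t, g t ∂μ = ∫ u in (0)..1, g (quantile F u) := by
  obtain ⟨h1, h2⟩ := eq_map_quantile hF hμ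
  rw [intervalIntegral.integral_of_le zero_le_one, ← integral_map h1, h2]
  exact hg.aestronglyMeasurable

omit hF in
theorem intervalIntegral_eq_of_eq_zero_outside {h k : ℝ → ℝ} {p r : ℝ} (hp : 0 ≤ p) (hpr : p ≤ r)
    (hr : r ≤ 1) (hin : ∀ u, p < u → u ≤ r → h u = k u) (hleft : ∀ u, 0 < u → u ≤ p → h u = 0)
    (hright : ∀ u, r < u → u ≤ 1 → h u = 0) :
    ∫ u in (0)..1, h u = ∫ u in p..r, k u := by
  rw [intervalIntegral.integral_of_le zero_le_one, intervalIntegral.integral_of_le hpr,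
    setIntegral_eq_of_subset_of_forall_sdiff_eq_zero measurableSet_Ioc
      (Set.Ioc_subset_Ioc hp hr) (f := h)]
  · exact setIntegral_congr_fun measurableSet_Ioc fun u hu => hin u hu.1 hu.2
  · rintro u ⟨hu, hu'⟩
    rcases le_or_gt u p with h1 | h1
    · exact hleft u hu.1 h1
    · exact hright u (not_le.1 fun h2 => hu' ⟨h1, h2⟩) hu.2

omit hF in
theorem measurable_truncatedCost (a b : ℝ) : Measurable (truncatedCost a b) :=
  Measurable.ite measurableSet_Iic (by fun_prop) measurable_const

theorem integral_truncatedCost {μ : Measure ℝ} [IsProbabilityMeasure μ]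
    (hμ : ∀ t, μ.real (Set.Iic t) = F t) {a b q : ℝ} (hb : F b = q) (hq : 0 ≤ q) (hq1 : q ≤ 1) :
    ∫ t, truncatedCost a b t ∂μ = ∫ u in (0)..q, |quantile F u - a| := by
  rw [integral_eq_integral_quantile hF hμ (measurable_truncatedCost a b)]
  refine intervalIntegral_eq_of_eq_zero_outside le_rfl hq hq1 (fun u h0 h1 => ?_)
    (fun u h0 h1 => absurd h1 (not_le.2 h0)) (fun u h0 h1 => ?_)
  · exact if_pos ((quantile_le_iff hF h0 (h1.trans hq1)).2 (hb ▸ h1))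
  · refine if_neg fun h => ?_
    have := (quantile_le_iff hF (by linarith) h1).1 h
    linarith

/-- Up to a multiple of the capacity constraint, no facility position is better than the median of
the extreme window of mass `q`. -/
theorem exists_threshold {μ : Measure ℝ} [IsProbabilityMeasure μ]
    (hμ : ∀ t, μ.real (Set.Iic t) = F t) {a b q : ℝ} (ha : F a = q / 2) (hb : F b = q)
    (hq : 0 ≤ q) (hq1 : q ≤ 1) {z : ℝ} (hz : z ∈ Set.Icc (0 : ℝ) 1) :
    ∃ ρ ∈ Set.Icc (0 : ℝ) 1,
      ∫ t, max 0 (ρ - |t - z|) ∂μ ≤ q * ρ - ∫ t, truncatedCost a b t ∂μ := by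
  have hF0 : ∀ t, 0 ≤ F t := fun t => hμ t ▸ measureReal_nonneg
  have hF1 : ∀ t, F t ≤ 1 := fun t => hμ t ▸ measureReal_le_one
  have hcont : Continuous fun ρ => F (z + ρ) - F (z - ρ) :=
    (hF.continuous.comp (by fun_prop)).sub (hF.continuous.comp (by fun_prop))
  -- The radius at which `[z - ρ, z + ρ]` has mass exactly `q`; its quantile levels form the window
  -- centred at `F (z - ρ) + q / 2`.
  obtain ⟨ρ, hρ, hρq⟩ := intermediate_value_Icc zero_le_one hcont.continuousOn
    (show q ∈ Set.Icc (F (z + 0) - F (z - 0)) (F (z + 1) - F (z - 1)) by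
      have h1 := hF.mono (show z - 1 ≤ 0 by linarith [hz.2])
      have h2 := hF.mono (show 1 ≤ z + 1 by linarith [hz.1])
      rw [hF.zero] at h1
      rw [hF.one] at h2
      simp only [add_zero, sub_zero, sub_self]
      exact ⟨hq, by linarith⟩)
  simp only at hρq
  refine ⟨ρ, hρ, ?_⟩
  rw [integral_truncatedCost hF hμ hb hq hq1, integral_eq_integral_quantile hF hμ (by fun_prop)]
  have hp := hF0 (z - ρ)
  have hr := hF1 (z + ρ)
  rw [intervalIntegral_eq_of_eq_zero_outside (p := F (z - ρ)) (r := F (z + ρ))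
    (k := fun u => ρ - |quantile F u - z|) hp (by linarith) hr,
    intervalIntegral.integral_sub intervalIntegrable_const
      ((intervalIntegrable_quantile hF (by linarith) hr).sub intervalIntegrable_const).abs,
    intervalIntegral.integral_const, hρq, smul_eq_mul]
  · have := integral_extreme_window_le hF (c := F (z - ρ) + q / 2) hq ha (by linarith)
      (by linarith) z
    rw [add_sub_cancel_right, add_assoc, add_halves, ← hρq, add_sub_cancel, hρq] at this
    linarith
  · intro u h1 h2
    have hu0 : 0 < u := hp.trans_lt h1
    have h3 := (quantile_le_iff hF hu0 (h2.trans hr)).2 h2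
    have h4 : z - ρ < quantile F u := by
      by_contra! h
      linarith [(quantile_le_iff hF hu0 (h2.trans hr)).1 h]
    refine max_eq_right (sub_nonneg.2 (abs_le.2 ⟨by linarith, by linarith⟩))
  · intro u h1 h2
    have h3 := (quantile_le_iff hF h1 (by linarith)).2 h2
    refine max_eq_left ?_
    linarith [neg_abs_le (quantile F u - z)]
  · intro u h1 h2
    refine max_eq_left ?_
    have h3 : z + ρ < quantile F u := by
      by_contra! h
      linarith [(quantile_le_iff hF (by linarith [hF0 (z + ρ)]) h2).1 h]
    linarith [le_abs_self (quantile F u - z)]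

end Quantile

/-! ### From single-dipped densities to distribution functions. -/

section SingleDipped

variable {μ : Measure ℝ}

theorem IsSingleDipped.absolutelyContinuous (h : IsSingleDipped μ) : μ ≪ volume := by
  obtain ⟨f, -, -, rfl, -⟩ := h
  exact (withDensity_absolutelyContinuous _ _).trans Measure.restrict_le_self.absolutelyContinuous

theorem IsSingleDipped.nullSingletonClass (h : IsSingleDipped μ) : NullSingletonClass μ :=
  ⟨fun t => h.absolutelyContinuous (measure_singleton t)⟩

theorem IsSingleDipped.ae_mem (h : IsSingleDipped μ) : ∀ᵐ t ∂μ, t ∈ Set.Icc (0 : ℝ) 1 := by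
  obtain ⟨f, -, -, rfl, -⟩ := h
  exact (withDensity_absolutelyContinuous _ _).ae_le (ae_restrict_mem measurableSet_Icc)

/-- The density of a symmetric law on `[0,1]` is symmetric almost everywhere. -/
theorem ae_density_symm [IsFiniteMeasure μ] {f : ℝ → ℝ} (hf : Measurable f) (hf0 : ∀ t, 0 ≤ f t)
    (hμ : μ = (volume.restrict (Set.Icc (0 : ℝ) 1)).withDensity fun t => ENNReal.ofReal (f t))
    (hsymm : IsSymmetric μ) : ∀ᵐ t, t ∈ Set.Icc (0 : ℝ) 1 → f (1 - t) = f t := by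
  set ν := volume.restrict (Set.Icc (0 : ℝ) 1) with hν
  have hpres : MeasurePreserving (fun t : ℝ => 1 - t) ν ν := by
    have h := (Measure.measurePreserving_sub_left volume (1 : ℝ)).restrict_preimage
      (measurableSet_Icc (a := (0 : ℝ)) (b := 1))
    simpa using h
  have hmeas : Measurable fun t => ENNReal.ofReal (f (1 - t)) := by fun_prop
  have hμ' : μ = ν.withDensity fun t => ENNReal.ofReal (f (1 - t)) := by
    ext s hs
    have hpre : MeasurableSet ((fun t : ℝ => 1 - t) ⁻¹' s) := by
      exact (by fun_prop : Measurable fun t : ℝ => 1 - t) hs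
    rw [withDensity_apply _ hs, ← hpres.setLIntegral_comp_preimage hs hmeas, ← hsymm,
      Measure.map_apply (by fun_prop) hs, hμ, withDensity_apply _ hpre]
    simp
  have hfin : ∫⁻ t, ENNReal.ofReal (f t) ∂ν ≠ ⊤ := by
    rw [← setLIntegral_univ, ← withDensity_apply _ MeasurableSet.univ, ← hμ]
    exact measure_ne_top μ _
  have heq := (withDensity_eq_iff (by fun_prop) (by fun_prop) hfin).1 (hμ.symm.trans hμ')
  rw [EventuallyEq, hν, ae_restrict_iff' measurableSet_Icc] at heq
  filter_upwards [heq] with t ht htI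
  have := ht htI
  rwa [eq_comm, ENNReal.ofReal_eq_ofReal_iff (hf0 _) (hf0 _)] at this

/-- Almost everywhere `f (u + l) ≤ f u`: by antitonicity if `u + l ≤ d`; otherwise because `f u = f
(1 - u)` and `d ≤ u + l ≤ 1 - u`. -/
theorem measure_Ioc_translate_le [IsFiniteMeasure μ] (hdip : IsSingleDipped μ)
    (hsymm : IsSymmetric μ) {α' α l : ℝ} (h0 : 0 ≤ α') (hl : 0 ≤ l) (h1 : 2 * α + l ≤ 1) :
    μ (Set.Ioc (α' + l) (α + l)) ≤ μ (Set.Ioc α' α) := by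
  rcases le_or_gt α α' with hle | hlt
  · rw [Set.Ioc_eq_empty (by linarith), measure_empty]
    exact zero_le
  obtain ⟨f, hf, hf0, hμ, d, -, hanti, hmono⟩ := hdip
  have hae := ae_density_symm hf hf0 hμ hsymm
  have happly : ∀ p r : ℝ, 0 ≤ p → r ≤ 1 →
      μ (Set.Ioc p r) = ∫⁻ t in Set.Ioc p r, ENNReal.ofReal (f t) := by
    intro p r hp hr
    rw [hμ, withDensity_apply _ measurableSet_Ioc, Measure.restrict_restrict measurableSet_Ioc,
      Set.inter_eq_left.2 (Set.Ioc_subset_Icc_self.trans (Set.Icc_subset_Icc hp hr))]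
  rw [happly _ _ (by linarith) (by linarith), happly _ _ h0 (by linarith),
    ← (measurePreserving_add_right volume l).setLIntegral_comp_preimage measurableSet_Ioc
      (by fun_prop), Set.preimage_add_const_Ioc, add_sub_cancel_right, add_sub_cancel_right]
  refine setLIntegral_mono_ae (by fun_prop) ?_
  filter_upwards [hae] with u hu hmem
  refine ENNReal.ofReal_le_ofReal ?_
  have hu0 : 0 < u := h0.trans_lt hmem.1
  have hu1 : 2 * u + l ≤ 1 := by linarith [hmem.2]
  rcases le_total (u + l) d with hd | hd
  · exact hanti ⟨⟨hu0, by linarith⟩, by simp only [Set.mem_Iic]; linarith⟩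
      ⟨⟨by linarith, by linarith⟩, hd⟩ (by linarith)
  · rw [← hu ⟨hu0.le, by linarith⟩]
    exact hmono ⟨⟨by linarith, by linarith⟩, hd⟩
      ⟨⟨by linarith, by linarith⟩, by simp only [Set.mem_Ici]; linarith⟩ (by linarith)

theorem isDippedCDF [IsProbabilityMeasure μ] (hdip : IsSingleDipped μ) (hsymm : IsSymmetric μ) :
    IsDippedCDF fun t => μ.real (Set.Iic t) := by
  have := hdip.nullSingletonClass
  have hdiff : ∀ {s t : ℝ}, s ≤ t →
      μ.real (Set.Iic t) - μ.real (Set.Iic s) = μ.real (Set.Ioc s t) := by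
    intro s t hst
    rw [← Set.Iic_sdiff_Iic, measureReal_sdiff (Set.Iic_subset_Iic.2 hst) measurableSet_Iic]
  have hmono : Monotone fun t => μ.real (Set.Iic t) := fun s t hst =>
    measureReal_mono (Set.Iic_subset_Iic.2 hst)
  refine ⟨hmono, ?_, ?_, ?_, ?_, ?_⟩
  · have hcdf : (fun t => μ.real (Set.Iic t)) = ProbabilityTheory.cdf μ :=
      funext fun t => (ProbabilityTheory.cdf_eq_real μ t).symm
    rw [hcdf, continuous_iff_continuousAt]
    intro t
    rw [(ProbabilityTheory.cdf μ).mono.continuousAt_iff_leftLim_eq_rightLim,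
      StieltjesFunction.rightLim_eq]
    have h := (ProbabilityTheory.cdf μ).measure_singleton t
    rw [ProbabilityTheory.measure_cdf, measure_singleton, eq_comm,
      ENNReal.ofReal_eq_zero] at h
    exact le_antisymm ((ProbabilityTheory.cdf μ).mono.leftLim_le le_rfl) (by linarith)
  · have h : μ (Set.Iic 0) = 0 := by
      rw [measure_congr Iio_ae_eq_Iic.symm]
      refine measure_mono_null (fun t ht => ?_) (ae_iff.1 hdip.ae_mem)
      exact fun h => absurd h.1 (not_le.2 ht)
    simp [measureReal_def, h]
  · have h : μ (Set.Iic 1) = 1 := by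
      rw [prob_compl_eq_zero_iff measurableSet_Iic |>.symm]
      refine measure_mono_null (fun t ht => ?_) (ae_iff.1 hdip.ae_mem)
      exact fun h => ht h.2
    simp [measureReal_def, h]
  · intro t
    have h1 : μ (Set.Iic (1 - t)) = μ (Set.Ici t) := by
      conv_lhs => rw [← hsymm, Measure.map_apply (by fun_prop) measurableSet_Iic]
      simp
    rw [measureReal_def, h1, ← measureReal_def, ← probReal_compl_eq_one_sub measurableSet_Iic,
      Set.compl_Iic, measureReal_def, measureReal_def, measure_congr Ioi_ae_eq_Ici]
  · intro α' α l h0 h1 h2 h3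
    rw [hdiff (by linarith), hdiff h1]
    exact ENNReal.toReal_mono (measure_ne_top _ _)
      (measure_Ioc_translate_le hdip hsymm h0 h2 h3)

end SingleDipped

/-! ### From pointwise bounds with deviations to expectations. -/

section Expectation

variable {μ : Measure ℝ} [IsProbabilityMeasure μ] {n : ℕ} {ι : Type*} [Fintype ι]
  {g : ι → ℝ → ℝ} {h : (Fin n → ℝ) → ℝ} {c : ℝ}

theorem lintegral_sum_deviation_le (hn : 0 < n) (hg : ∀ l, Measurable (g l))
    (hg' : ∀ l, ∀ᵐ t ∂μ, g l t ∈ Set.Icc (0 : ℝ) 1) :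
    ∫⁻ x, ENNReal.ofReal (∑ l, deviation μ (g l) n x) ∂(Measure.pi fun _ : Fin n => μ) ≤
      ENNReal.ofReal (Fintype.card ι * √n) := by
  have h1 : ∀ x : Fin n → ℝ, ENNReal.ofReal (∑ l, deviation μ (g l) n x) =
      ∑ l, ENNReal.ofReal (deviation μ (g l) n x) := fun x =>
    ENNReal.ofReal_sum_of_nonneg fun l _ => abs_nonneg _
  simp only [h1]
  rw [lintegral_finsetSum _ fun l _ => (measurable_deviation (hg l)).ennreal_ofReal]
  refine (Finset.sum_le_sum fun l _ => lintegral_deviation_le (hg l) (hg' l) hn).trans ?_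
  rw [Finset.sum_const, Finset.card_univ, nsmul_eq_mul,
    ENNReal.ofReal_mul (Nat.cast_nonneg _), ENNReal.ofReal_natCast]

theorem lintegral_le_of_le_deviation (hn : 0 < n) (hg : ∀ l, Measurable (g l))
    (hg' : ∀ l, ∀ᵐ t ∂μ, g l t ∈ Set.Icc (0 : ℝ) 1) (hc : 0 ≤ c)
    (hle : ∀ᵐ x ∂(Measure.pi fun _ : Fin n => μ), h x ≤ c + ∑ l, deviation μ (g l) n x) :
    ∫⁻ x, ENNReal.ofReal (h x) ∂(Measure.pi fun _ : Fin n => μ) ≤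
      ENNReal.ofReal (c + Fintype.card ι * √n) := by
  rw [ENNReal.ofReal_add hc (by positivity)]
  calc ∫⁻ x, ENNReal.ofReal (h x) ∂(Measure.pi fun _ : Fin n => μ)
      ≤ ∫⁻ x, (ENNReal.ofReal c + ENNReal.ofReal (∑ l, deviation μ (g l) n x))
          ∂(Measure.pi fun _ : Fin n => μ) := by
        refine lintegral_mono_ae (hle.mono fun x hx => ?_)
        exact (ENNReal.ofReal_le_ofReal hx).trans ENNReal.ofReal_add_le
    _ = ENNReal.ofReal c + ∫⁻ x, ENNReal.ofReal (∑ l, deviation μ (g l) n x)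
          ∂(Measure.pi fun _ : Fin n => μ) := by
        rw [lintegral_add_left measurable_const, lintegral_const, measure_univ, mul_one]
    _ ≤ _ := by gcongr; exact lintegral_sum_deviation_le hn hg hg'

theorem expect_le_of_le_deviation (hn : 0 < n) (hg : ∀ l, Measurable (g l))
    (hg' : ∀ l, ∀ᵐ t ∂μ, g l t ∈ Set.Icc (0 : ℝ) 1) (hc : 0 ≤ c)
    (hle : ∀ᵐ x ∂(Measure.pi fun _ : Fin n => μ), h x ≤ c + ∑ l, deviation μ (g l) n x) :
    expect μ n h ≤ c + Fintype.card ι * √n :=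
  ENNReal.toReal_le_of_le_ofReal (by positivity) (lintegral_le_of_le_deviation hn hg hg' hc hle)

/-- Finiteness is required since `toReal` sends `⊤` to `0`. As `h` need not be measurable, the
integral is split along the measurable deviations. -/
theorem le_expect_of_le_deviation (hn : 0 < n) (hg : ∀ l, Measurable (g l))
    (hg' : ∀ l, ∀ᵐ t ∂μ, g l t ∈ Set.Icc (0 : ℝ) 1)
    (hfin : ∫⁻ x, ENNReal.ofReal (h x) ∂(Measure.pi fun _ : Fin n => μ) ≠ ⊤)
    (hle : ∀ᵐ x ∂(Measure.pi fun _ : Fin n => μ), c ≤ h x + ∑ l, deviation μ (g l) n x) :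
    c ≤ expect μ n h + Fintype.card ι * √n := by
  have hmeas : Measurable fun x : Fin n → ℝ => ENNReal.ofReal (∑ l, deviation μ (g l) n x) :=
    (Finset.measurable_fun_sum _ fun l _ => measurable_deviation (hg l)).ennreal_ofReal
  have key : ENNReal.ofReal c ≤ ENNReal.ofReal (expect μ n h + Fintype.card ι * √n) := by
    rw [expect, ENNReal.ofReal_add ENNReal.toReal_nonneg (by positivity),
      ENNReal.ofReal_toReal hfin]
    calc ENNReal.ofReal c = ∫⁻ _, ENNReal.ofReal c ∂(Measure.pi fun _ : Fin n => μ) := by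
          rw [lintegral_const, measure_univ, mul_one]
      _ ≤ ∫⁻ x, (ENNReal.ofReal (h x) + ENNReal.ofReal (∑ l, deviation μ (g l) n x))
            ∂(Measure.pi fun _ : Fin n => μ) := by
          refine lintegral_mono_ae (hle.mono fun x hx => ?_)
          exact (ENNReal.ofReal_le_ofReal hx).trans ENNReal.ofReal_add_le
      _ = ∫⁻ x, ENNReal.ofReal (h x) ∂(Measure.pi fun _ : Fin n => μ) +
            ∫⁻ x, ENNReal.ofReal (∑ l, deviation μ (g l) n x)
              ∂(Measure.pi fun _ : Fin n => μ) := lintegral_add_right _ hmeas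
      _ ≤ _ := by gcongr; exact lintegral_sum_deviation_le hn hg hg'
  have hnonneg : 0 ≤ expect μ n h + Fintype.card ι * √n :=
    add_nonneg ENNReal.toReal_nonneg (by positivity)
  exact (ENNReal.ofReal_le_ofReal_iff hnonneg).1 key

theorem tendsto_div_of_abs_sub_le {u : ℕ → ℝ} {L : ℝ}
    (h : ∀ ε > 0, ∃ c : ℝ, ∀ n : ℕ, 0 < n → |u n - n * L| ≤ n * ε + c * √n) :
    Tendsto (fun n : ℕ => u n / n) atTop (𝓝 L) := by
  rw [Metric.tendsto_nhds]
  intro ε hε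
  obtain ⟨c, hc⟩ := h (ε / 2) (half_pos hε)
  have hlim : Tendsto (fun n : ℕ => c / √(n : ℝ)) atTop (𝓝 0) :=
    tendsto_const_nhds.div_atTop (Real.tendsto_sqrt_atTop.comp tendsto_natCast_atTop_atTop)
  filter_upwards [hlim.eventually (gt_mem_nhds (half_pos hε)), eventually_gt_atTop 0] with n h1 hn
  have hn' : (0 : ℝ) < n := by exact_mod_cast hn
  have hs : 0 < √(n : ℝ) := Real.sqrt_pos.2 hn'
  have hsq : √(n : ℝ) * √n = n := Real.mul_self_sqrt hn'.le
  have h2 : u n / n - L = (u n - n * L) / n := by field_simp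
  have h3 : (n * (ε / 2) + c * √n) / n = ε / 2 + c / √n := by
    rw [add_div, mul_div_cancel_left₀ _ hn'.ne']
    congr 1
    rw [div_eq_div_iff hn'.ne' hs.ne', mul_assoc, hsq]
  rw [Real.dist_eq, h2, abs_div, abs_of_pos hn']
  calc |u n - n * L| / n ≤ (n * (ε / 2) + c * √n) / n := by gcongr; exact hc n hn
    _ < ε := by linarith

end Expectation

/-! ### Asymptotic optimality. -/

section Asymptotics

variable {μ : Measure ℝ}

/-- The value per agent of serving a fraction `q` of the agents at one end of `[0,1]` is an upper
bound for serving them from any facility position, up to finitely many deviations. -/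
theorem exists_net_bound {q C : ℝ}
    (hC : ∀ z ∈ Set.Icc (0 : ℝ) 1, ∃ ρ ∈ Set.Icc (0 : ℝ) 1,
      ∫ t, max 0 (ρ - |t - z|) ∂μ ≤ q * ρ - C) {ε : ℝ} (hε : 0 < ε) :
    ∃ (m : ℕ) (g : Fin m → ℝ → ℝ), (∀ l, Measurable (g l)) ∧
      (∀ l t, g l t ∈ Set.Icc (0 : ℝ) 1) ∧
      ∀ (n : ℕ) (x : Fin n → ℝ) (k : ℕ) (z : ℝ), (∀ i, x i ∈ Set.Icc (0 : ℝ) 1) →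
        (k : ℝ) ≤ q * n → ∃ ρ ≤ 1, k * (1 - ρ) + ∑ i, max 0 (ρ - |x i - z|) ≤
          n * (q - C + ε) + ∑ l, deviation μ (g l) n x := by
  obtain ⟨K, hK⟩ := exists_nat_gt (1 / ε)
  have hK0 : (0 : ℝ) < K := (one_div_pos.2 hε).trans hK
  have hnet : ∀ l : Fin (K + 1), ((l : ℕ) : ℝ) / K ∈ Set.Icc (0 : ℝ) 1 := fun l =>
    ⟨by positivity, (div_le_one hK0).2 (by exact_mod_cast Nat.lt_succ_iff.1 l.2)⟩
  choose ρ hρ hρC using fun l : Fin (K + 1) => hC _ (hnet l)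
  refine ⟨K + 1, fun l t => max 0 (ρ l - |t - (l : ℕ) / K|), fun l => by fun_prop,
    fun l t => ⟨le_max_left _ _, max_le zero_le_one ?_⟩, fun n x k z hx hk => ?_⟩
  · linarith [(hρ l).2, abs_nonneg (t - (l : ℕ) / K)]
  -- Projecting `z` to `[0,1]` brings it no farther from any agent; then it is rounded down to a
  -- grid of mesh `1 / K < ε`, whose size does not depend on `n`.
  obtain ⟨z', hz', hzz'⟩ : ∃ z' ∈ Set.Icc (0 : ℝ) 1, ∀ i, |x i - z'| ≤ |x i - z| := by
    refine ⟨max 0 (min 1 z), ⟨le_max_left _ _, max_le zero_le_one (min_le_left _ _)⟩, fun i => ?_⟩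
    have hi := hx i
    rcases le_total z 0 with h | h
    · rw [min_eq_right (by linarith), max_eq_left h, abs_of_nonneg (by linarith [hi.1]),
        abs_of_nonneg (by linarith [hi.1])]
      linarith
    · rcases le_total z 1 with h' | h'
      · rw [min_eq_right h', max_eq_right h]
      · rw [min_eq_left h', max_eq_right zero_le_one, abs_of_nonpos (by linarith [hi.2]),
          abs_of_nonpos (by linarith [hi.2])]
        linarith
  have hl : ⌊z' * K⌋₊ < K + 1 := by
    rw [Nat.lt_succ_iff]
    exact Nat.floor_le_of_le (mul_le_of_le_one_left hK0.le hz'.2)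
  set l : Fin (K + 1) := ⟨⌊z' * K⌋₊, hl⟩ with hldef
  have hclose : |z' - (l : ℕ) / K| ≤ ε := by
    have h1 : ((l : ℕ) : ℝ) ≤ z' * K := Nat.floor_le (mul_nonneg hz'.1 hK0.le)
    have h2 : z' * K < (l : ℕ) + 1 := Nat.lt_floor_add_one _
    have h3 : ((l : ℕ) : ℝ) / K ≤ z' := (div_le_iff₀ hK0).2 h1
    have h4 : z' < (l : ℕ) / K + 1 / K := by
      rw [← add_div]
      exact (lt_div_iff₀ hK0).2 h2
    have h5 : 1 / (K : ℝ) < ε := (one_div_lt hε hK0).1 hK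
    rw [abs_of_nonneg (by linarith)]
    linarith
  refine ⟨ρ l, (hρ l).2, ?_⟩
  set g : ℝ → ℝ := fun t => max 0 (ρ l - |t - (l : ℕ) / K|) with hg
  have hterm : ∀ i, max 0 (ρ l - |x i - z|) ≤ g (x i) + ε := by
    intro i
    refine max_le (add_nonneg (le_max_left _ _) hε.le) ?_
    have h1 := le_max_right 0 (ρ l - |x i - (l : ℕ) / K|)
    have h2 := abs_sub_le (x i) z' ((l : ℕ) / K)
    simp only [hg]
    linarith [hzz' i]
  have hsum : ∑ i, max 0 (ρ l - |x i - z|) ≤ ∑ i, g (x i) + n * ε := by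
    refine (Finset.sum_le_sum fun i _ => hterm i).trans_eq ?_
    rw [Finset.sum_add_distrib]
    simp
  have hdev : deviation μ g n x ≤
      ∑ l : Fin (K + 1), deviation μ (fun t => max 0 (ρ l - |t - (l : ℕ) / K|)) n x :=
    Finset.single_le_sum (f := fun l : Fin (K + 1) =>
      deviation μ (fun t => max 0 (ρ l - |t - (l : ℕ) / K|)) n x)
      (fun _ _ => abs_nonneg _) (Finset.mem_univ l)
  have h1 : ∑ i, g (x i) - n * ∫ t, g t ∂μ ≤ deviation μ g n x := le_abs_self _
  have h2 : (n : ℝ) * ∫ t, g t ∂μ ≤ n * (q * ρ l - C) :=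
    mul_le_mul_of_nonneg_left (hρC l) (Nat.cast_nonneg n)
  have h3 : (k : ℝ) * (1 - ρ l) ≤ q * n * (1 - ρ l) :=
    mul_le_mul_of_nonneg_right hk (by linarith [(hρ l).2])
  linarith

theorem measurable_leftIndicator (b : ℝ) : Measurable (leftIndicator b) :=
  Measurable.ite measurableSet_Iic measurable_const measurable_const

theorem integral_leftIndicator (b : ℝ) : ∫ t, leftIndicator b t ∂μ = μ.real (Set.Iic b) := by
  rw [← integral_indicator_one measurableSet_Iic]
  refine integral_congr_ae (Eventually.of_forall fun t => ?_)
  simp [leftIndicator, Set.indicator_apply]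

theorem integral_comp_reflect (hsymm : IsSymmetric μ) {g : ℝ → ℝ} (hg : Measurable g) :
    ∫ t, g (1 - t) ∂μ = ∫ t, g t ∂μ := by
  conv_rhs => rw [← hsymm]
  rw [integral_map (by fun_prop) hg.aestronglyMeasurable]

theorem truncatedCost_mem {a b t : ℝ} (ha : a ∈ Set.Icc (0 : ℝ) 1) (ht : t ∈ Set.Icc (0 : ℝ) 1) :
    truncatedCost a b t ∈ Set.Icc (0 : ℝ) 1 := by
  unfold truncatedCost
  split_ifs
  · exact ⟨abs_nonneg _, abs_sub_le_one ht ha⟩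
  · simp

theorem leftIndicator_mem (b t : ℝ) : leftIndicator b t ∈ Set.Icc (0 : ℝ) 1 := by
  unfold leftIndicator
  split_ifs <;> simp

variable [IsProbabilityMeasure μ]

theorem exists_extreme_window (hdip : IsSingleDipped μ) (hsymm : IsSymmetric μ) {q : ℝ}
    (hq : 0 ≤ q) (hq1 : q ≤ 1) :
    ∃ a ∈ Set.Icc (0 : ℝ) 1, ∃ b : ℝ, ∫ t, leftIndicator b t ∂μ = q ∧
      ∫ t, truncatedCost a b t ∂μ ≤ q / 2 ∧
      ∀ z ∈ Set.Icc (0 : ℝ) 1, ∃ ρ ∈ Set.Icc (0 : ℝ) 1,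
        ∫ t, max 0 (ρ - |t - z|) ∂μ ≤ q * ρ - ∫ t, truncatedCost a b t ∂μ := by
  have hF := isDippedCDF hdip hsymm
  have hivt : ∀ p, 0 ≤ p → p ≤ 1 → ∃ t ∈ Set.Icc (0 : ℝ) 1, μ.real (Set.Iic t) = p := by
    intro p hp hp1
    refine intermediate_value_Icc zero_le_one hF.continuous.continuousOn ?_
    rw [hF.zero, hF.one]
    exact ⟨hp, hp1⟩
  obtain ⟨a, ha, hFa⟩ := hivt (q / 2) (by linarith) (by linarith)
  obtain ⟨b, -, hFb⟩ := hivt q hq hq1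
  refine ⟨a, ha, b, (integral_leftIndicator b).trans hFb, ?_, fun z hz =>
    exists_threshold hF (fun _ => rfl) hFa hFb hq hq1 hz⟩
  rw [integral_truncatedCost hF (fun _ => rfl) hFb hq hq1]
  exact integral_extreme_window_le_half hF hq hq1 hFa

theorem asymptoticallyOptimal_percentile {q₁ q₂ : ℝ} (hq₁ : 0 ≤ q₁) (hq₂ : 0 ≤ q₂)
    (hpos : 0 < q₁ + q₂) (hq : q₁ + q₂ ≤ 2 / 3) (hdip : IsSingleDipped μ)
    (hsymm : IsSymmetric μ) (τ : ∀ n : ℕ, Fin 2 → Equiv.Perm (Fin n)) :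
    AsymptoticallyOptimal μ ![q₁, q₂] τ (percentileMechanism ![q₁ / 2, 1 - q₂ / 2]) := by
  have := hdip.nullSingletonClass
  have hstable := equilibriumStable_percentile hq₁ hq₂ hq τ
  obtain ⟨a₁, ha₁, b₁, hb₁, hC₁, hz₁⟩ := exists_extreme_window hdip hsymm hq₁ (by linarith)
  obtain ⟨a₂, ha₂, b₂, hb₂, hC₂, hz₂⟩ := exists_extreme_window hdip hsymm hq₂ (by linarith)
  set C₁ := ∫ t, truncatedCost a₁ b₁ t ∂μ with hC₁def
  set C₂ := ∫ t, truncatedCost a₂ b₂ t ∂μ with hC₂def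
  set L := (q₁ - C₁) + (q₂ - C₂) with hL
  have hLpos : 0 < L := by linarith
  set M := percentileMechanism ![q₁ / 2, 1 - q₂ / 2] with hM
  have hmem : ∀ n : ℕ, ∀ᵐ x ∂(Measure.pi fun _ : Fin n => μ), ∀ i, x i ∈ Set.Icc (0 : ℝ) 1 :=
    fun n => ae_forall_of_ae hdip.ae_mem
  have hupper : ∀ ε > 0, ∃ c : ℝ, ∀ n : ℕ, 0 < n →
      ∫⁻ x, ENNReal.ofReal (optWelfare (capacity ![q₁, q₂] n) (τ n) x)
        ∂(Measure.pi fun _ : Fin n => μ) ≤ ENNReal.ofReal (n * (L + ε) + c * √n) ∧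
      expect μ n (optWelfare (capacity ![q₁, q₂] n) (τ n)) ≤ n * (L + ε) + c * √n := by
    intro ε hε
    obtain ⟨m₁, g₁, hg₁, hg₁', hbd₁⟩ := exists_net_bound hz₁ (half_pos hε)
    obtain ⟨m₂, g₂, hg₂, hg₂', hbd₂⟩ := exists_net_bound hz₂ (half_pos hε)
    refine ⟨Fintype.card (Fin m₁ ⊕ Fin m₂), fun n hn => ?_⟩
    have hg : ∀ l, Measurable (Sum.elim g₁ g₂ l) := by
      rintro (l | l)
      · exact hg₁ l
      · exact hg₂ l
    have hg' : ∀ l, ∀ᵐ t ∂μ, Sum.elim g₁ g₂ l t ∈ Set.Icc (0 : ℝ) 1 := by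
      rintro (l | l)
      · exact Eventually.of_forall (hg₁' l)
      · exact Eventually.of_forall (hg₂' l)
    have hle : ∀ᵐ x ∂(Measure.pi fun _ : Fin n => μ),
        optWelfare (capacity ![q₁, q₂] n) (τ n) x ≤
          n * (L + ε) + ∑ l, deviation μ (Sum.elim g₁ g₂ l) n x := by
      filter_upwards [hmem n] with x hx
      refine optWelfare_le hstable hx fun y => ?_
      obtain ⟨ρ₁, hρ₁, h1⟩ := hbd₁ n x (capacity ![q₁, q₂] n 0) (y 0) hx
        (capacity_le (q := ![q₁, q₂]) (j := 0) hq₁)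
      obtain ⟨ρ₂, hρ₂, h2⟩ := hbd₂ n x (capacity ![q₁, q₂] n 1) (y 1) hx
        (capacity_le (q := ![q₁, q₂]) (j := 1) hq₂)
      refine ⟨![ρ₁, ρ₂], Fin.forall_fin_two.2 ⟨hρ₁, hρ₂⟩, ?_⟩
      rw [Fin.sum_univ_two, Fintype.sum_sum_type]
      refine (add_le_add h1 h2).trans_eq ?_
      simp only [Sum.elim_inl, Sum.elim_inr, hL]
      ring
    have hc : (0 : ℝ) ≤ n * (L + ε) := by positivity
    exact ⟨lintegral_le_of_le_deviation hn hg hg' hc hle,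
      expect_le_of_le_deviation hn hg hg' hc hle⟩
  have hfin : ∀ n : ℕ, 0 < n → ∫⁻ x, ENNReal.ofReal (optWelfare (capacity ![q₁, q₂] n) (τ n) x)
      ∂(Measure.pi fun _ : Fin n => μ) ≠ ⊤ := by
    intro n hn
    obtain ⟨c, hc⟩ := hupper 1 one_pos
    exact ((hc n hn).1.trans_lt ENNReal.ofReal_lt_top).ne
  have hle : ∀ n : ℕ, ∫⁻ x, ENNReal.ofReal (mechWelfare ![q₁, q₂] τ M n x)
      ∂(Measure.pi fun _ : Fin n => μ) ≤
      ∫⁻ x, ENNReal.ofReal (optWelfare (capacity ![q₁, q₂] n) (τ n) x)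
        ∂(Measure.pi fun _ : Fin n => μ) := fun n =>
    lintegral_mono_ae ((hmem n).mono fun x hx =>
      ENNReal.ofReal_le_ofReal (mechWelfare_le_optWelfare hstable hx))
  -- Each facility loses 3 for its inexact median and 1 for the rounding of its capacity, hence 8; a
  -- cost and an indicator at each end give four deviations.
  have hlower : ∀ n : ℕ, 0 < n → n * L - 8 ≤ expect μ n (mechWelfare ![q₁, q₂] τ M n) + 4 * √n := by
    intro n hn
    let g : Fin 4 → ℝ → ℝ := ![truncatedCost a₁ b₁, leftIndicator b₁,
      fun t => truncatedCost a₂ b₂ (1 - t), fun t => leftIndicator b₂ (1 - t)]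
    have hrefl : Measurable fun t : ℝ => 1 - t := by fun_prop
    have hg : ∀ l, Measurable (g l) := by
      intro l
      fin_cases l
      · exact measurable_truncatedCost a₁ b₁
      · exact measurable_leftIndicator b₁
      · exact (measurable_truncatedCost a₂ b₂).comp hrefl
      · exact (measurable_leftIndicator b₂).comp hrefl
    have hg' : ∀ l, ∀ᵐ t ∂μ, g l t ∈ Set.Icc (0 : ℝ) 1 := by
      intro l
      filter_upwards [hdip.ae_mem] with t ht
      fin_cases l
      · exact truncatedCost_mem ha₁ ht
      · exact leftIndicator_mem b₁ t
      · exact truncatedCost_mem ha₂ ⟨by linarith [ht.2], by linarith [ht.1]⟩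
      · exact leftIndicator_mem b₂ (1 - t)
    have key := le_expect_of_le_deviation (c := n * L - 8) hn hg hg'
      (((hle n).trans_lt (hfin n hn).lt_top).ne) ?_
    · simpa using key
    filter_upwards [hmem n, ae_injective] with x hx hinj
    have hw := le_mechWelfare hq₁ hq₂ hq τ hn hx hinj ha₁ ha₂ b₁ b₂
    have d0 : ∑ i, truncatedCost a₁ b₁ (x i) - n * C₁ ≤ deviation μ (g 0) n x := le_abs_self _
    have d1 : -(∑ i, leftIndicator b₁ (x i) - n * q₁) ≤ deviation μ (g 1) n x := by
      rw [← hb₁]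
      exact neg_le_abs _
    have d2 : ∑ i, truncatedCost a₂ b₂ (1 - x i) - n * C₂ ≤ deviation μ (g 2) n x := by
      rw [hC₂def, ← integral_comp_reflect hsymm (measurable_truncatedCost a₂ b₂)]
      exact le_abs_self _
    have d3 : -(∑ i, leftIndicator b₂ (1 - x i) - n * q₂) ≤ deviation μ (g 3) n x := by
      rw [← hb₂, ← integral_comp_reflect hsymm (measurable_leftIndicator b₂)]
      exact neg_le_abs _
    have k1 : (capacity ![q₁, q₂] n 0 : ℝ) ≤ q₁ * n := capacity_le (q := ![q₁, q₂]) (j := 0) hq₁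
    have k2 : q₁ * n < (capacity ![q₁, q₂] n 0 : ℝ) + 1 := lt_capacity_add_one ![q₁, q₂] 0
    have k3 : (capacity ![q₁, q₂] n 1 : ℝ) ≤ q₂ * n := capacity_le (q := ![q₁, q₂]) (j := 1) hq₂
    have k4 : q₂ * n < (capacity ![q₁, q₂] n 1 : ℝ) + 1 := lt_capacity_add_one ![q₁, q₂] 1
    have m1 : max 0 ((capacity ![q₁, q₂] n 0 : ℝ) - ∑ i, leftIndicator b₁ (x i)) ≤
        deviation μ (g 1) n x := max_le (abs_nonneg _) (by linarith)
    have m2 : max 0 ((capacity ![q₁, q₂] n 1 : ℝ) - ∑ i, leftIndicator b₂ (1 - x i)) ≤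
        deviation μ (g 3) n x := max_le (abs_nonneg _) (by linarith)
    rw [Fin.sum_univ_four, hL]
    linarith
  have hmono : ∀ n : ℕ, 0 < n → expect μ n (mechWelfare ![q₁, q₂] τ M n) ≤
      expect μ n (optWelfare (capacity ![q₁, q₂] n) (τ n)) := fun n hn =>
    ENNReal.toReal_mono (hfin n hn) (hle n)
  have hsqrt : ∀ n : ℕ, 0 < n → 1 ≤ √(n : ℝ) := fun n hn =>
    Real.one_le_sqrt.2 (by exact_mod_cast hn)
  have hbounds : ∀ ε > 0, ∃ c : ℝ, 0 ≤ c ∧ ∀ n : ℕ, 0 < n →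
      n * L - (n * ε + c * √n) ≤ expect μ n (mechWelfare ![q₁, q₂] τ M n) ∧
      expect μ n (optWelfare (capacity ![q₁, q₂] n) (τ n)) ≤ n * L + (n * ε + c * √n) := by
    intro ε hε
    obtain ⟨c, hc⟩ := hupper ε hε
    -- Since `1 ≤ √n`, the loss `8 + 4 * √n` is at most `12 * √n`.
    refine ⟨max c 12, le_max_of_le_right (by norm_num), fun n hn => ⟨?_, ?_⟩⟩
    · have h1 : 12 * √(n : ℝ) ≤ max c 12 * √n := by gcongr; exact le_max_right _ _
      have h2 : 0 ≤ n * ε := by positivity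
      linarith [hlower n hn, hsqrt n hn]
    · have h1 : c * √(n : ℝ) ≤ max c 12 * √n := by gcongr; exact le_max_left _ _
      linarith [(hc n hn).2]
  have hmech : Tendsto (fun n : ℕ => expect μ n (mechWelfare ![q₁, q₂] τ M n) / n) atTop (𝓝 L) := by
    refine tendsto_div_of_abs_sub_le fun ε hε => ?_
    obtain ⟨c, -, hc⟩ := hbounds ε hε
    refine ⟨c, fun n hn => abs_sub_le_iff.2 ⟨?_, ?_⟩⟩
    · linarith [(hc n hn).2, hmono n hn]
    · linarith [(hc n hn).1]
  have hopt : Tendsto (fun n : ℕ => expect μ n (optWelfare (capacity ![q₁, q₂] n) (τ n)) / n)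
      atTop (𝓝 L) := by
    refine tendsto_div_of_abs_sub_le fun ε hε => ?_
    obtain ⟨c, -, hc⟩ := hbounds ε hε
    refine ⟨c, fun n hn => abs_sub_le_iff.2 ⟨?_, ?_⟩⟩
    · linarith [(hc n hn).2]
    · linarith [(hc n hn).1, hmono n hn]
  refine ⟨⟨L, hmech, hopt⟩, ?_⟩
  have hratio := hopt.div hmech hLpos.ne'
  rw [div_self hLpos.ne'] at hratio
  refine hratio.congr' ?_
  filter_upwards [eventually_gt_atTop 0] with n hn
  have hn' : (n : ℝ) ≠ 0 := by exact_mod_cast hn.ne'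
  exact div_div_div_cancel_right₀ hn' _ _

end Asymptotics

end FacilityLocation

theorem mainTheorem12 (q₁ q₂ : ℝ) (hq₁ : 0 ≤ q₁) (hq₂ : 0 ≤ q₂) (hpos : 0 < q₁ + q₂)
    (hq : q₁ + q₂ ≤ 2 / 3) (μ : Measure ℝ) [IsProbabilityMeasure μ]
    (hdip : FacilityLocation.IsSingleDipped μ) (hsymm : FacilityLocation.IsSymmetric μ)
    (τ : ∀ n : ℕ, Fin 2 → Equiv.Perm (Fin n)) :
    FacilityLocation.EquilibriumStable ![q₁, q₂] τ
        (FacilityLocation.percentileMechanism ![q₁ / 2, 1 - q₂ / 2]) ∧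
      FacilityLocation.AsymptoticallyOptimal μ ![q₁, q₂] τ
        (FacilityLocation.percentileMechanism ![q₁ / 2, 1 - q₂ / 2]) :=
  ⟨FacilityLocation.equilibriumStable_percentile hq₁ hq₂ hq τ,
    FacilityLocation.asymptoticallyOptimal_percentile hq₁ hq₂ hpos hq hdip hsymm τ⟩
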